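/- **Setting.** Fix $p\in(0,1)$ and functions $c,s:\mathbb N^+\to\mathbb R$ of the security parameter $\lambda$. Space is the real line, all signals travel at speed $1$, clocks are synchronised, and local computation takes no time. Efficient means uniform polynomial time in $\lambda$ (Turing machines with a uniformly random tape for classical parties; for quantum parties, polynomially many qubits driven by such a classical machine that prints circuits over $\{H,T,\mathrm{CNOT}\}$, with intermediate measurements). All communication with the verifiers is classical. A *1D position verification protocol* for the position $p$ has two efficient classical verifiers $V_0,V_1$, located at $0$ and $1$, who share a private random tape and a private classical channel of speed $1$. It has polynomially many rounds with publicly scheduled times. In each round each verifier broadcasts a (possibly empty) message, computed from the shared tape and from the prover messages known to that verifier at that time (directly or over the private channel). The messages of the round reach the point $p$ no later than the prescribed time of the prover's reply for this round, and after the prescribed time of the previous reply. The prover then broadcasts a reply of polynomially bounded length. Each verifier has a deadline for each reply, and a reply broadcast from $p$ at the prescribed time meets it. At the end the verifiers accept or reject on the basis of the random tape and of everything received on time. * The protocol has *completeness $c$ for an efficient prover at $p$* if there is an efficient quantum prover which, located at $p$, is accepted with probability at least $c(\lambda)$ for every $\lambda$. * It has *soundness $s$ against two efficient classical adversaries* if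 the following holds for every uniformly generated family of strategies of two efficient classical adversaries, one located in $[0,p)$ and the other in $(p,1]$. The adversaries share a random tape and a private channel of speed $1$, and may send different messages to the two verifiers. There is a negligible function $\nu$ such that, for every $\lambda$, the verifiers accept with probability at most $s(\lambda)+\nu(\lambda)$. A *proof of quantumness with completeness $c$ and soundness $s$* is an ordinary (untimed) interactive protocol with polynomially many rounds and an efficient classical verifier such that some efficient quantum prover is accepted with probability at least $c(\lambda)$ for every $\lambda$, while for every efficient classical prover there is a negligible $\nu$ such that it is accepted with probability at most $s(\lambda)+\nu(\lambda)$ for every $\lambda$. **Theorem.** If there is a 1D position verification protocol with efficient classical verifiers at $0$ and $1$ that has completeness $c$ for an efficient prover at $p\in(0,1)$ and soundness $s$ against two efficient classical adversaries, one located in $[0,p)$ and the other in $(p,1]$, then there is a proof of quantumness with completeness $c$ and soundness $s$. -/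

import Mathlib

/-! # Classically verifiable position verification in one dimension, and proofs of quantumness

All programs are uniform: they are functions computed by multi-stack Turing machines in polynomial
time (`Turing.TM2ComputableInPolyTime`), and they always get the security parameter in unary. -/

namespace CVPV

/-! ## Polynomial-time programs -/

/-- Bit strings. -/
abbrev Str := List Bool

/-- `1ⁿ`. -/
def unary (n : ℕ) : Str := List.replicate n true

/-- A finite list of bit strings as it is written on a tape: every string is followed by the
separator `none`. -/
def tape (l : List Str) : List (Option Bool) := l.flatMap fun s => s.map some ++ [none]

/-- `f` is computable by a Turing machine in time polynomial in the length of its input. -/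
def PolyTime (f : List Str → Str) : Prop :=
  Nonempty (Turing.TM2ComputableInPolyTime tape id f)

/-- The natural number `f n` is computed in binary from `1ⁿ` in polynomial time. -/
def PolyTimeNat (f : ℕ → ℕ) : Prop :=
  Nonempty (Turing.TM2ComputableInPolyTime unary Computability.encodeNat f)

/-- Gates of quantum circuits, with the indices of the qubits they act on. -/
inductive Gate
  | H (i : ℕ)
  | T (i : ℕ)
  | CNOT (control target : ℕ)

/-- The description of a gate: its name and the indices of its qubits in unary. -/
def Gate.code : Gate → List Str
  | .H i => [[false, false], unary i]
  | .T i => [[false, true], unary i]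
  | .CNOT i j => [[true], unary i, unary j]

/-- `g` is computable by a Turing machine in polynomial time; the machine prints the list of
gates. -/
def PolyTimeCircuit (g : List Str → List Gate) : Prop :=
  Nonempty (Turing.TM2ComputableInPolyTime tape (fun c => tape (c.flatMap Gate.code)) g)

/-- `f` is negligible: it is nonnegative and decays faster than every inverse polynomial. -/
def Negligible (f : ℕ+ → ℝ) : Prop :=
  (∀ n, 0 ≤ f n) ∧
    Asymptotics.SuperpolynomialDecay Filter.atTop (fun n : ℕ+ => ((n : ℕ) : ℝ)) f

/-- The expectation of `f r` for a uniformly random string `r` of `k` bits. -/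
noncomputable def coinAvg (k : ℕ) (f : Str → ℝ) : ℝ :=
  (∑ r : Fin k → Bool, f (List.ofFn r)) / 2 ^ k

/-! ## Quantum registers -/

/-- (Unnormalised) pure states of `q` qubits, as amplitudes in the computational basis. -/
abbrev QState (q : ℕ) := (Fin q → Bool) → ℂ

/-- The state `|0…0⟩`. -/
noncomputable def QState.zero (q : ℕ) : QState q :=
  fun x => if x = fun _ => false then 1 else 0

/-- The action of a gate. An ill-formed gate (a qubit that does not exist, or a CNOT whose control
is its target) does nothing. -/
noncomputable def Gate.apply {q : ℕ} : Gate → QState q → QState q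
  | .H i, ψ => fun x =>
      if h : i < q then
        (ψ (Function.update x ⟨i, h⟩ false) +
          (if x ⟨i, h⟩ then -1 else 1) * ψ (Function.update x ⟨i, h⟩ true)) / (Real.sqrt 2 : ℂ)
      else ψ x
  | .T i, ψ => fun x =>
      if h : i < q then
        (if x ⟨i, h⟩ then Complex.exp (Real.pi / 4 * Complex.I) else 1) * ψ x
      else ψ x
  | .CNOT i j, ψ => fun x =>
      if h : i < q ∧ j < q ∧ i ≠ j then
        ψ (Function.update x ⟨j, h.2.1⟩ (xor (x ⟨j, h.2.1⟩) (x ⟨i, h.1⟩)))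
      else ψ x

/-- Run a circuit; the head of the list is the first gate. -/
noncomputable def runCircuit {q : ℕ} (c : List Gate) (ψ : QState q) : QState q :=
  c.foldl (fun φ g => g.apply φ) ψ

/-- The unnormalised state after the first `m` of `m + w` qubits were measured in the computational
basis with outcome `z`; its squared norm carries the probability of the outcome. -/
def project {m w : ℕ} (z : Fin m → Bool) (ψ : QState (m + w)) : QState (m + w) :=
  fun x => if ∀ i : Fin m, x (Fin.castAdd w i) = z i then ψ x else 0

/-! ## Provers in interactive protocols with a classical verifier -/

/-- An interactive quantum polynomial-time machine with classical communication: a register of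
polynomially many qubits, kept through the whole interaction and driven by a classical
polynomial-time program. In every round the program reads the history (the messages received so far
and the earlier measurement outcomes), prints a circuit that is applied to the register, the first
`measured` qubits are measured, and the reply is computed from the history and the outcome. -/
structure QuantumProver where
  measured : Polynomial ℕ
  work : Polynomial ℕ
  circuit : List Str → List Gate
  circuit_poly : PolyTimeCircuit circuit
  reply : List Str → Str
  reply_poly : PolyTime reply

/-- The probability that the remaining `k` rounds lead to acceptance. The incoming message of the
next round is `env ys` if `ys` are the replies sent so far, the final decision is to accept iff
`verdict ys = [true]`; replies are cut after `L` bits, `n` is the security parameter, `hist` the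
history, and `ψ` the unnormalised state of the register. -/
noncomputable def QuantumProver.accFrom (Q : QuantumProver) (n L : ℕ) (env verdict : List Str → Str) :
    ℕ → (hist ys : List Str) → QState (Q.measured.eval n + Q.work.eval n) → ℝ
  | 0, _, ys, ψ => if verdict ys = [true] then ∑ x, ‖ψ x‖ ^ 2 else 0
  | k + 1, hist, ys, ψ =>
      ∑ z : Fin (Q.measured.eval n) → Bool,
        Q.accFrom n L env verdict k
          (hist ++ [env ys, List.ofFn z])
          (ys ++ [(Q.reply (unary n :: (hist ++ [env ys, List.ofFn z]))).take L])
          (project z (runCircuit (Q.circuit (unary n :: (hist ++ [env ys]))) ψ))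

/-- The probability that `Q` is accepted after `N` rounds. -/
noncomputable def QuantumProver.accProb (Q : QuantumProver) (n L N : ℕ)
    (env verdict : List Str → Str) : ℝ :=
  Q.accFrom n L env verdict N [] [] (QState.zero _)

/-- A probabilistic polynomial-time interactive machine, given by its next-message function: with
random tape `ρ` it answers the messages `x₀, …, xᵢ` with `reply [1ⁿ, ρ, x₀, …, xᵢ]`. -/
structure ClassicalProver where
  coins : Polynomial ℕ
  reply : List Str → Str
  reply_poly : PolyTime reply

/-- The messages received and the replies sent by a classical prover with random tape `ρ` in the
first `k` rounds. -/
def ClassicalProver.transcript (P : ClassicalProver) (n L : ℕ) (ρ : Str) (env : List Str → Str) :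
    ℕ → List Str × List Str
  | 0 => ([], [])
  | k + 1 =>
      let t := P.transcript n L ρ env k
      let xs := t.1 ++ [env t.2]
      (xs, t.2 ++ [(P.reply (unary n :: ρ :: xs)).take L])

/-! ## Proofs of quantumness -/

/-- An interactive protocol with an efficient classical verifier. There are `rounds` rounds; in each
of them the verifier sends a message and the prover replies with at most `msgLen` bits. The
verifier, with random tape `r`, sends `next [1ⁿ, r, y₀, …, yᵢ₋₁]` after the replies `y₀, …, yᵢ₋₁`,
and accepts at the end iff `accept [1ⁿ, r, y₀, …]` is the string `1`. -/
structure InteractiveProtocol where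
  rounds : Polynomial ℕ
  msgLen : Polynomial ℕ
  coins : Polynomial ℕ
  next : List Str → Str
  next_poly : PolyTime next
  accept : List Str → Str
  accept_poly : PolyTime accept

/-- The probability that the quantum prover `Q` convinces the verifier. -/
noncomputable def InteractiveProtocol.quantumProb (V : InteractiveProtocol) (Q : QuantumProver)
    (n : ℕ) : ℝ :=
  coinAvg (V.coins.eval n) fun r =>
    Q.accProb n (V.msgLen.eval n) (V.rounds.eval n)
      (fun ys => V.next (unary n :: r :: ys)) (fun ys => V.accept (unary n :: r :: ys))

/-- The probability that the classical prover `P` convinces the verifier. -/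
noncomputable def InteractiveProtocol.classicalProb (V : InteractiveProtocol) (P : ClassicalProver)
    (n : ℕ) : ℝ :=
  coinAvg (V.coins.eval n) fun r => coinAvg (P.coins.eval n) fun ρ =>
    if V.accept (unary n :: r ::
        (P.transcript n (V.msgLen.eval n) ρ (fun ys => V.next (unary n :: r :: ys))
          (V.rounds.eval n)).2) = [true]
    then 1 else 0

/-- `V` is a proof of quantumness with completeness `c` and soundness `s`. -/
def InteractiveProtocol.IsProofOfQuantumness (V : InteractiveProtocol) (c s : ℕ+ → ℝ) : Prop :=
  (∃ Q : QuantumProver, ∀ n : ℕ+, c n ≤ V.quantumProb Q n) ∧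
    ∀ P : ClassicalProver, ∃ ν : ℕ+ → ℝ, Negligible ν ∧ ∀ n : ℕ+, V.classicalProb P n ≤ s n + ν n

/-! ## Position verification -/

/-- The two verifiers `V₀ = false` and `V₁ = true` are at the points `0` and `1` of the line. -/
def loc (v : Bool) : ℝ := if v then 1 else 0

/-- The first `i` rows of a table of strings, written row by row. -/
def rows (c : Bool → ℕ → Str) (i : ℕ) : List Str :=
  (List.range i).flatMap fun j => [c false j, c true j]

/-- A position verification protocol with two efficient classical verifiers, for a prover that
claims to be at `p`. Everything travels at speed `1` and computation takes no time.

In round `i`, the verifier `v` broadcasts one message at time `sendTime n v i`; the prover broadcasts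
one reply of at most `msgLen` bits at time `replyTime n i`; the verifier `v` reads as the reply
number `i` what reaches it by the time `deadline n v i`. (An omitted message is the empty string;
rounds are delimited by what has reached the point `p`.)

The verifiers share a random tape `r` and a private channel. If `c v j` is the reply number `j` as
read by `v`, then the message of `v` in round `i` is
`send v [1ⁿ, r, c V₀ 0, c V₁ 0, …, c V₀ (i-1), c V₁ (i-1)]`. By `causal`, it depends only on those
`c v' j` that are known to `v` when the message is sent, directly or through the private channel.
(By the conditions on the times, replies of the rounds `j ≥ i` are never known at that moment.)
At the end the verifiers accept iff `accept [1ⁿ, r, c V₀ 0, c V₁ 0, …]` is the string `1`. -/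
structure PVProtocol (p : ℝ) where
  rounds : Polynomial ℕ
  msgLen : Polynomial ℕ
  coins : Polynomial ℕ
  sendTime : ℕ → Bool → ℕ → ℝ
  replyTime : ℕ → ℕ → ℝ
  deadline : ℕ → Bool → ℕ → ℝ
  /-- The messages of round `i` are at the point `p` when the reply number `i` is due. -/
  send_le_reply : ∀ n v i, i < rounds.eval n → sendTime n v i + |p - loc v| ≤ replyTime n i
  /-- The messages of round `i + 1` get to the point `p` after the reply number `i`. -/
  reply_lt_send : ∀ n v i, i + 1 < rounds.eval n →
    replyTime n i < sendTime n v (i + 1) + |p - loc v|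
  /-- A reply that is broadcast from the point `p` on time meets the deadlines. -/
  reply_le_deadline : ∀ n v i, i < rounds.eval n → replyTime n i + |p - loc v| ≤ deadline n v i
  send : Bool → List Str → Str
  send_poly : ∀ v, PolyTime (send v)
  causal : ∀ (n : ℕ) (r : Str) (v : Bool) (i : ℕ), i < rounds.eval n → ∀ c c' : Bool → ℕ → Str,
    (∀ v' j, j < i → deadline n v' j + |loc v' - loc v| ≤ sendTime n v i → c v' j = c' v' j) →
    send v (unary n :: r :: rows c i) = send v (unary n :: r :: rows c' i)
  accept : List Str → Str
  accept_poly : PolyTime accept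

variable {p : ℝ}

/-- The pair of messages a prover receives in one round, as one string: the bits of the first one
are each preceded by `1`, a single `0` marks its end, and the second one follows. -/
def pairCode (a b : Str) : Str := (a.flatMap fun x => [true, x]) ++ false :: b

/-- What the verifiers read if an honest prover at `p` broadcasts the replies `ys` on time: both of
them read every reply. -/
def heardByBoth (ys : List Str) : List Str := ys.flatMap fun y => [y, y]

/-- The probability that the verifiers accept the prover `Q`, located at `p`. -/
noncomputable def PVProtocol.honestProb (V : PVProtocol p) (Q : QuantumProver) (n : ℕ) : ℝ :=
  coinAvg (V.coins.eval n) fun r =>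
    Q.accProb n (V.msgLen.eval n) (V.rounds.eval n)
      (fun ys => pairCode (V.send false (unary n :: r :: heardByBoth ys))
        (V.send true (unary n :: r :: heardByBoth ys)))
      (fun ys => V.accept (unary n :: r :: heardByBoth ys))

/-- Completeness `c` for an efficient prover located at `p`. -/
def PVProtocol.Complete (V : PVProtocol p) (c : ℕ+ → ℝ) : Prop :=
  ∃ Q : QuantumProver, ∀ n : ℕ+, c n ≤ V.honestProb Q n

/-- A (uniformly generated family of) strategies of two efficient classical adversaries
`A₀ = false`, `A₁ = true` that avoid the point `p`: `A₀` is in `[0, p)` and `A₁` is in `(p, 1]`.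
They share a random tape and a private channel of speed `1`. The string that `a` sends to the
verifier `v` as reply number `i` is `act a v` of `1ⁿ`, the random tape, `1ⁱ`, and all that `a` may
know at the latest moment for sending it. An empty string means that nothing is sent. -/
structure Adversaries (p : ℝ) where
  num : Bool → ℕ → ℕ
  den : Bool → ℕ → ℕ
  num_poly : ∀ a, PolyTimeNat (num a)
  den_poly : ∀ a, PolyTimeNat (den a)
  left_mem : ∀ n, (num false n / den false n : ℝ) ∈ Set.Ico 0 p
  right_mem : ∀ n, (num true n / den true n : ℝ) ∈ Set.Ioc p 1
  coins : Polynomial ℕ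
  act : Bool → Bool → List Str → Str
  act_poly : ∀ a v, PolyTime (act a v)

/-- The position of the adversary `a`. -/
noncomputable def Adversaries.pos (A : Adversaries p) (n : ℕ) (a : Bool) : ℝ :=
  A.num a n / A.den a n

/-- The broadcast of `b` in round `j` is known to `a` when `a` has to send its string for the reply
number `i` to `v`: it was observed by one of the adversaries `a'`, and there was time to relay it
from `a'` to `a` and for the string of `a` to get to `v` by the deadline. What is sent only at the
deadline itself is not known to `a`, even if `a` is at the same place as `b` and `v`. -/
def Adversaries.Knows (A : Adversaries p) (V : PVProtocol p) (n : ℕ) (a v : Bool) (i : ℕ)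
    (b : Bool) (j : ℕ) : Prop :=
  V.sendTime n b j < V.deadline n v i ∧
    ∃ a' : Bool, V.sendTime n b j + |A.pos n a' - loc b| + |A.pos n a' - A.pos n a|
      + |A.pos n a - loc v| ≤ V.deadline n v i

open Classical in
/-- What `a` knows of the verifiers' messages `m` then: a known message is preceded by the bit `1`,
an unknown one is replaced by the empty string. -/
noncomputable def Adversaries.view (A : Adversaries p) (V : PVProtocol p) (n : ℕ) (a v : Bool)
    (i : ℕ) (m : Bool → ℕ → Str) : List Str :=
  rows (fun b j => if A.Knows V n a v i b j then true :: m b j else []) (V.rounds.eval n)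

/-- The string that `a` sends to `v` as the reply number `i`. -/
noncomputable def Adversaries.sent (A : Adversaries p) (V : PVProtocol p) (n : ℕ) (ρ : Str)
    (a v : Bool) (i : ℕ) (m : Bool → ℕ → Str) : Str :=
  A.act a v (unary n :: ρ :: unary i :: A.view V n a v i m)

/-- `m b j` (the broadcast of `b` in round `j`) and `c v i` (the reply number `i` as read by `v`)
are the messages in the run with random tapes `r` of the verifiers and `ρ` of the adversaries. They
are determined for all rounds, since each of them depends only on earlier events. If both
adversaries send something to the same verifier in the same round, the one on its side of the
prover is heard. -/
def Adversaries.IsRun (A : Adversaries p) (V : PVProtocol p) (n : ℕ) (r ρ : Str)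
    (m c : Bool → ℕ → Str) : Prop :=
  ∀ i < V.rounds.eval n, ∀ v : Bool,
    m v i = V.send v (unary n :: r :: rows c i) ∧
    c v i = (if A.sent V n ρ v v i m = [] then A.sent V n ρ (!v) v i m
      else A.sent V n ρ v v i m).take (V.msgLen.eval n)

open Classical in
/-- The probability that the verifiers accept if the adversaries use the strategy `A`. -/
noncomputable def PVProtocol.advProb (V : PVProtocol p) (A : Adversaries p) (n : ℕ) : ℝ :=
  coinAvg (V.coins.eval n) fun r => coinAvg (A.coins.eval n) fun ρ =>
    if ∃ m c, A.IsRun V n r ρ m c ∧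
      V.accept (unary n :: r :: rows c (V.rounds.eval n)) = [true]
    then 1 else 0

/-- Soundness `s` against two efficient classical adversaries, one on each side of `p`. -/
def PVProtocol.Sound (V : PVProtocol p) (s : ℕ+ → ℝ) : Prop :=
  ∀ A : Adversaries p, ∃ ν : ℕ+ → ℝ, Negligible ν ∧ ∀ n : ℕ+, V.advProb A n ≤ s n + ν n

end CVPV

/-! A single untimed verifier can play both verifiers: it draws their common tape, sends the two
messages of a round as one string, and treats every reply as read by both. A prover at `p` meets all
deadlines, so the honest experiment is literally unchanged and completeness carries over
(`quantumProb_toInteractive`).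

For soundness, a classical prover `P` is a deterministic function of its tape and of the messages,
so it can be run in two places at once, which is not possible with a quantum register. Two
adversaries at `0` and `1` share the tape of `P`, and each answers the verifier next to it as `P`
would. They have the messages in time: a message of the verifier `b` must reach `p` before the reply
is due there, and that reply must still reach `v` by the deadline; by the triangle inequality the
direct way from `b` to `v` is no longer than the way through `p` (`knows_toAdversaries`). The two
copies give the same answers, so the verifiers read exactly the transcript of `P` (`exists_isRun`),
and the soundness error of the given protocol bounds that of the new one.

Efficiency has to be shown for concrete machines. The new verifier and the adversaries are old
programs run after a rewriting of the input (`doubleReplies`, `encodeView`), so polynomial time must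
be closed under composition and pairing. For this, `TM2` programs are translated to machines with
one stack operation per step (`nonempty_of_tm2`), which are easy to combine, and translated back
(`tm2`). -/

namespace CVPV

open Function Turing

/-! ## Stack machines

A variant of the machine model `Turing.TM2` in which every step is a single stack operation. -/

/-- An operation of a stack machine with states `S`. -/
inductive StackOp {K : Type} (Γ : K → Type) (S : Type)
  | push (k : K) (a : Γ k) (q : S)
  | pop (k : K) (f : Option (Γ k) → S)
  | peek (k : K) (f : Option (Γ k) → S)
  | jump (q : S)
  | halt

/-- The contents of all stacks. -/
abbrev Store {K : Type} (Γ : K → Type) := ∀ k, List (Γ k)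

variable {K : Type} {Γ : K → Type} {S S' : Type}

namespace StackOp

/-- Rename the states by `e`, and replace `halt` by a jump to `x`. -/
def redirect (e : S → S') (x : S') : StackOp Γ S → StackOp Γ S'
  | push k a q => push k a (e q)
  | pop k f => pop k fun o => e (f o)
  | peek k f => peek k fun o => e (f o)
  | jump q => jump (e q)
  | halt => jump x

variable [DecidableEq K]

/-- The effect of an operation; `none` if the machine halts. -/
def next : StackOp Γ S → Store Γ → Option (S × Store Γ)
  | push k a q, s => some (q, update s k (a :: s k))
  | pop k f, s => some (f (s k).head?, update s k (s k).tail)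
  | peek k f, s => some (f (s k).head?, s)
  | jump q, s => some (q, s)
  | halt, _ => none

theorem next_redirect_of_some {e : S → S'} {x : S'} {o : StackOp Γ S} {s s₁ : Store Γ} {q : S}
    (h : o.next s = some (q, s₁)) : (o.redirect e x).next s = some (e q, s₁) := by
  cases o <;> simp_all [next, redirect]
  all_goals grind

theorem next_redirect_of_none {e : S → S'} {x : S'} {o : StackOp Γ S} {s : Store Γ}
    (h : o.next s = none) : (o.redirect e x).next s = some (x, s) := by
  cases o <;> simp_all [next, redirect]

theorem length_le_of_next {o : StackOp Γ S} {s s₁ : Store Γ} {q : S}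
    (h : o.next s = some (q, s₁)) (k : K) : (s₁ k).length ≤ (s k).length + 1 := by
  cases o with
  | push k' a q' =>
    simp only [next, Option.some.injEq, Prod.mk.injEq] at h
    obtain ⟨-, rfl⟩ := h
    by_cases hk : k = k'
    · subst hk; simp
    · simp [hk]
  | pop k' f =>
    simp only [next, Option.some.injEq, Prod.mk.injEq] at h
    obtain ⟨-, rfl⟩ := h
    by_cases hk : k = k'
    · subst hk; simp; omega
    · simp [hk]
  | peek k' f => simp_all [next]
  | jump q' => simp_all [next]
  | halt => simp [next] at h

end StackOp

section HaltsIn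

variable [DecidableEq K]

/-- `HaltsIn code q s s' t`: started in the state `q` with the stacks `s`, the machine halts after
at most `t` steps with the stacks `s'`. -/
inductive HaltsIn (code : S → StackOp Γ S) : S → Store Γ → Store Γ → ℕ → Prop
  | halt {q : S} {s : Store Γ} {t : ℕ} (h : (code q).next s = none) : HaltsIn code q s s t
  | step {q q' : S} {s s₁ s' : Store Γ} {t : ℕ} (h : (code q).next s = some (q', s₁))
      (h' : HaltsIn code q' s₁ s' t) : HaltsIn code q s s' (t + 1)

variable {code : S → StackOp Γ S} {q : S} {s s' : Store Γ} {t : ℕ}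

theorem HaltsIn.mono (h : HaltsIn code q s s' t) {u : ℕ} (hu : t ≤ u) : HaltsIn code q s s' u := by
  induction h generalizing u with
  | halt h => exact .halt h
  | step h _ ih =>
    obtain ⟨u, rfl⟩ : ∃ w, u = w + 1 := ⟨u - 1, by omega⟩
    exact .step h (ih (by omega))

/-- A step pushes at most one symbol. This later bounds the length of an output by the running time.
-/
theorem HaltsIn.length_le (h : HaltsIn code q s s' t) (k : K) :
    (s' k).length ≤ (s k).length + t := by
  induction h with
  | halt h => omega
  | step h _ ih => have := StackOp.length_le_of_next h k; omega

/-- A machine that is a part of another one and hands over to the state `x` when it halts. -/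
theorem HaltsIn.embed {code' : S' → StackOp Γ S'} {e : S → S'} {x : S'} {s'' : Store Γ} {u : ℕ}
    (h : HaltsIn code q s s' t) (he : ∀ q, code' (e q) = (code q).redirect e x)
    (hx : HaltsIn code' x s' s'' u) : HaltsIn code' (e q) s s'' (t + u + 1) := by
  induction h with
  | halt h =>
    exact (HaltsIn.step (by rw [he]; exact StackOp.next_redirect_of_none h) hx).mono (by omega)
  | step h _ ih =>
    exact (HaltsIn.step (by rw [he]; exact StackOp.next_redirect_of_some h) (ih hx)).mono
      (by omega)

end HaltsIn

/-- A stack machine with finitely many states. -/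
structure StackMachine {K : Type} (Γ : K → Type) where
  S : Type
  [fin : Fintype S]
  start : S
  code : S → StackOp Γ S

attribute [instance] StackMachine.fin

namespace StackMachine

/-- The machine that halts at once. -/
def skip : StackMachine Γ where
  S := Unit
  start := ()
  code _ := .halt

/-- Push one symbol. -/
def push (k : K) (a : Γ k) : StackMachine Γ where
  S := Bool
  start := false
  code q := if q then .halt else .push k a true

/-- Run `P`, then `Q`. -/
def seq (P Q : StackMachine Γ) : StackMachine Γ where
  S := P.S ⊕ Q.S
  start := .inl P.start
  code
    | .inl q => (P.code q).redirect .inl (.inr Q.start)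
    | .inr q => match Q.code q with
      | .push k a q => .push k a (.inr q)
      | .pop k f => .pop k fun o => .inr (f o)
      | .peek k f => .peek k fun o => .inr (f o)
      | .jump q => .jump (.inr q)
      | .halt => .halt

/-- Pop a symbol from `k`, run the machine that `body` gives for it, and start again if `body` says
so. -/
def loop (k : K) [Fintype (Γ k)] (body : Option (Γ k) → StackMachine Γ × Bool) :
    StackMachine Γ where
  S := Bool ⊕ Σ o, (body o).1.S
  start := .inl false
  code
    | .inl false => .pop k fun o => .inr ⟨o, (body o).1.start⟩
    | .inl true => .halt
    -- `inl false` is the entry and `inl true` the exit, hence the negation of the flag that asks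
    -- for another round.
    | .inr ⟨o, q⟩ => ((body o).1.code q).redirect (fun q => .inr ⟨o, q⟩) (.inl !(body o).2)

/-- The same machine on the stacks `κ k` of a larger collection. -/
def lift {K' : Type} {Γ' : K' → Type} (κ : K → K') (P : StackMachine fun k => Γ' (κ k)) :
    StackMachine Γ' where
  S := P.S
  start := P.start
  code q := match P.code q with
    | .push k a q => .push (κ k) a q
    | .pop k f => .pop (κ k) f
    | .peek k f => .peek (κ k) f
    | .jump q => .jump q
    | .halt => .halt

variable [DecidableEq K]

/-- Started with the stacks `s`, the machine halts after at most `t` steps with the stacks `s'`. -/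
def Runs (P : StackMachine Γ) (s s' : Store Γ) (t : ℕ) : Prop :=
  HaltsIn P.code P.start s s' t

variable {P Q : StackMachine Γ} {s s' s'' : Store Γ} {t u : ℕ}

theorem Runs.mono (h : P.Runs s s' t) (hu : t ≤ u) : P.Runs s s' u := HaltsIn.mono h hu

theorem runs_skip : (skip : StackMachine Γ).Runs s s t := .halt rfl

theorem runs_push {k : K} {a : Γ k} : (push k a).Runs s (update s k (a :: s k)) 1 :=
  .step (q' := true) rfl (.halt rfl)

theorem Runs.seq (h : P.Runs s s' t) (h' : Q.Runs s' s'' u) :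
    (P.seq Q).Runs s s'' (t + u + 1) := by
  refine HaltsIn.embed (e := Sum.inl) (x := Sum.inr Q.start) h (fun _ => rfl) ?_
  -- The second machine keeps its own `halt`, so `HaltsIn.embed` does not apply and its run is
  -- copied step by step.
  have key : ∀ {q s s' u}, HaltsIn Q.code q s s' u →
      HaltsIn (P.seq Q).code (.inr q) s s' u := by
    intro q s s' u h
    induction h with
    | @halt q s t h =>
      refine .halt ?_
      simp only [StackMachine.seq]
      cases hc : Q.code q <;> simp_all [StackOp.next]
    | @step q q' s s₁ s' t h _ ih =>
      refine .step ?_ ih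
      simp only [StackMachine.seq]
      cases hc : Q.code q <;> simp_all [StackOp.next]; all_goals grind
  exact key h'

section Loop

variable {k : K} [Fintype (Γ k)] {body : Option (Γ k) → StackMachine Γ × Bool}

/-- The two additional steps are the pop and the jump that replaces the `halt` of the body. -/
theorem runs_loop_of_stop (hb : (body (s k).head?).2 = false)
    (h : (body (s k).head?).1.Runs (update s k (s k).tail) s' t) :
    (loop k body).Runs s s' (t + 2) := by
  refine .step (q' := .inr ⟨(s k).head?, (body (s k).head?).1.start⟩) rfl ?_
  refine HaltsIn.embed (code' := (loop k body).code) (u := 0)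
    (e := fun q => (Sum.inr ⟨(s k).head?, q⟩ : Bool ⊕ Σ o, (body o).1.S))
    (x := Sum.inl !(body (s k).head?).2) h (fun _ => rfl) ?_
  rw [hb]
  exact .halt rfl

theorem runs_loop_of_continue (hb : (body (s k).head?).2 = true)
    (h : (body (s k).head?).1.Runs (update s k (s k).tail) s' t)
    (h' : (loop k body).Runs s' s'' u) :
    (loop k body).Runs s s'' (t + u + 2) := by
  refine .step (q' := .inr ⟨(s k).head?, (body (s k).head?).1.start⟩) rfl ?_
  refine HaltsIn.embed (code' := (loop k body).code)
    (e := fun q => (Sum.inr ⟨(s k).head?, q⟩ : Bool ⊕ Σ o, (body o).1.S))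
    (x := Sum.inl !(body (s k).head?).2) h (fun _ => rfl) ?_
  rw [hb]
  exact h'

end Loop

/-- By injectivity an update at `κ k` changes no other stack `κ k₁`, so the run restricts to the
small collection. Stacks outside the range of `κ` are never touched. -/
theorem Runs.lift {K' : Type} [DecidableEq K'] {Γ' : K' → Type} {κ : K → K'} (hκ : Injective κ)
    {P : StackMachine fun k => Γ' (κ k)} {s s' : Store Γ'}
    (h : P.Runs (fun k => s (κ k)) (fun k => s' (κ k)) t)
    (hs : ∀ k', (∀ k, κ k ≠ k') → s k' = s' k') : (P.lift κ).Runs s s' t := by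
  have key : ∀ {q r r' t}, HaltsIn P.code q r r' t → ∀ s s' : Store Γ', (fun k => s (κ k)) = r →
      (fun k => s' (κ k)) = r' → (∀ k', (∀ k, κ k ≠ k') → s k' = s' k') →
      HaltsIn (P.lift κ).code q s s' t := by
    intro q r r' t h
    induction h with
    | @halt q r t h =>
      rintro s s' rfl hr hs
      obtain rfl : s = s' := by
        funext k'
        by_cases hk : ∃ k, κ k = k'
        · obtain ⟨k, rfl⟩ := hk
          exact (congrFun hr k).symm
        · exact hs k' (by simpa using hk)
      refine .halt ?_
      simp only [StackMachine.lift]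
      cases hc : P.code q <;> simp_all [StackOp.next]
    | @step q q' r r₁ r' t h _ ih =>
      rintro s s' rfl rfl hs
      have upd : ∀ (k : K) (l : List (Γ' (κ k))),
          (fun k₁ => update s (κ k) l (κ k₁)) = update (fun k₁ => s (κ k₁)) k l :=
        fun k l => update_comp_eq_of_injective' s hκ k l
      have off : ∀ (k : K) (l : List (Γ' (κ k))) (k' : K'), (∀ k, κ k ≠ k') →
          update s (κ k) l k' = s' k' := by
        intro k l k' hk
        rw [update_of_ne (hk k).symm, hs k' hk]
      cases hc : P.code q <;> rw [hc] at h <;>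
        simp only [StackOp.next, Option.some.injEq, Prod.mk.injEq, reduceCtorEq] at h
      case push k a q'' =>
        obtain ⟨rfl, rfl⟩ := h
        exact .step (by simp only [StackMachine.lift, hc]; rfl) (ih _ _ (upd _ _) rfl (off _ _))
      case pop k f =>
        obtain ⟨rfl, rfl⟩ := h
        exact .step (by simp only [StackMachine.lift, hc]; rfl) (ih _ _ (upd _ _) rfl (off _ _))
      case peek k f =>
        obtain ⟨rfl, rfl⟩ := h
        exact .step (by simp only [StackMachine.lift, hc]; rfl) (ih _ _ rfl rfl hs)
      case jump q'' =>
        obtain ⟨rfl, rfl⟩ := h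
        exact .step (by simp only [StackMachine.lift, hc]; rfl) (ih _ _ rfl rfl hs)
  exact key h s s' rfl rfl hs

end StackMachine

/-! ## Translation from and to `Turing.TM2` -/

section OfTM2

variable {Λ σ : Type}

/-- The number of operations in a statement. -/
def stmtSize : TM2.Stmt Γ Λ σ → ℕ
  | .push _ _ q => stmtSize q + 1
  | .peek _ _ q => stmtSize q + 1
  | .pop _ _ q => stmtSize q + 1
  | .load _ q => stmtSize q + 1
  | .branch _ q₁ q₂ => stmtSize q₁ + stmtSize q₂ + 1
  | .goto _ => 1
  | .halt => 1

/-- The positions inside a program, together with the values of the variables. -/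
abbrev Position (M : Λ → TM2.Stmt Γ Λ σ) : Type :=
  {q : TM2.Stmt Γ Λ σ // ∃ l, q ∈ TM2.stmts₁ (M l)} × σ

variable {M : Λ → TM2.Stmt Γ Λ σ}

theorem substmt_mem {q q' : TM2.Stmt Γ Λ σ} (h : ∃ l, q ∈ TM2.stmts₁ (M l))
    (hq : q' ∈ TM2.stmts₁ q) : ∃ l, q' ∈ TM2.stmts₁ (M l) :=
  h.imp fun _ hl => TM2.stmts₁_trans hl hq

open Classical in
/-- The operation at a position. -/
noncomputable def stmtOp : (q : TM2.Stmt Γ Λ σ) → (∃ l, q ∈ TM2.stmts₁ (M l)) → σ →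
    StackOp Γ (Position M)
  | .push k f q, h, v =>
      .push k (f v) (⟨q, substmt_mem h (by simp [TM2.stmts₁, TM2.stmts₁_self])⟩, v)
  | .peek k f q, h, v =>
      .peek k fun o => (⟨q, substmt_mem h (by simp [TM2.stmts₁, TM2.stmts₁_self])⟩, f v o)
  | .pop k f q, h, v =>
      .pop k fun o => (⟨q, substmt_mem h (by simp [TM2.stmts₁, TM2.stmts₁_self])⟩, f v o)
  | .load f q, h, v => .jump (⟨q, substmt_mem h (by simp [TM2.stmts₁, TM2.stmts₁_self])⟩, f v)
  | .branch f q₁ q₂, h, v =>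
      .jump (if f v then ⟨q₁, substmt_mem h (by simp [TM2.stmts₁, TM2.stmts₁_self])⟩
        else ⟨q₂, substmt_mem h (by simp [TM2.stmts₁, TM2.stmts₁_self])⟩, v)
  | .goto l, _, v => .jump (⟨M (l v), l v, TM2.stmts₁_self⟩, v)
  | .halt, _, _ => .halt

variable [DecidableEq K]

/-- One step of `TM2` executes a whole statement; induction on the statement splits it into single
operations. A statement ends by halting or by a `goto`, and in the second case an arbitrary
continuation of `t` steps is appended. -/
theorem haltsIn_stmt (q : TM2.Stmt Γ Λ σ) (h : ∃ l, q ∈ TM2.stmts₁ (M l)) (v : σ) (s s' : Store Γ)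
    (t : ℕ) :
    (∀ v', TM2.stepAux q v s = ⟨none, v', s'⟩ →
      HaltsIn (fun x : Position M => stmtOp x.1.1 x.1.2 x.2) (⟨q, h⟩, v) s s' (stmtSize q)) ∧
    ∀ l v' s₁, TM2.stepAux q v s = ⟨some l, v', s₁⟩ →
      HaltsIn (fun x : Position M => stmtOp x.1.1 x.1.2 x.2) (⟨M l, l, TM2.stmts₁_self⟩, v') s₁ s' t →
      HaltsIn (fun x : Position M => stmtOp x.1.1 x.1.2 x.2) (⟨q, h⟩, v) s s' (t + stmtSize q) := by
  induction q generalizing v s with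
  | push k f q ih =>
    exact ⟨fun v' e => .step rfl ((ih _ _ _).1 v' e),
      fun l v' s₁ e h' => .step rfl ((ih _ _ _).2 l v' s₁ e h')⟩
  | peek k f q ih =>
    exact ⟨fun v' e => .step rfl ((ih _ _ _).1 v' e),
      fun l v' s₁ e h' => .step rfl ((ih _ _ _).2 l v' s₁ e h')⟩
  | pop k f q ih =>
    exact ⟨fun v' e => .step rfl ((ih _ _ _).1 v' e),
      fun l v' s₁ e h' => .step rfl ((ih _ _ _).2 l v' s₁ e h')⟩
  | load f q ih =>
    exact ⟨fun v' e => .step rfl ((ih _ _ _).1 v' e),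
      fun l v' s₁ e h' => .step rfl ((ih _ _ _).2 l v' s₁ e h')⟩
  | branch f q₁ q₂ ih₁ ih₂ =>
    have h₁ := substmt_mem h (q' := q₁) (by simp [TM2.stmts₁, TM2.stmts₁_self])
    have h₂ := substmt_mem h (q' := q₂) (by simp [TM2.stmts₁, TM2.stmts₁_self])
    simp only [stmtSize]
    cases hf : f v
    · refine ⟨fun v' e => ?_, fun l v' s₁ e h' => ?_⟩ <;> simp only [TM2.stepAux, hf, cond_false] at e
      · refine .step (by simp [stmtOp, hf, StackOp.next])
          (((ih₂ h₂ _ _).1 v' e).mono (by omega))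
      · refine HaltsIn.mono (.step (by simp [stmtOp, hf, StackOp.next])
          ((ih₂ h₂ _ _).2 l v' s₁ e h')) (by omega)
    · refine ⟨fun v' e => ?_, fun l v' s₁ e h' => ?_⟩ <;> simp only [TM2.stepAux, hf, cond_true] at e
      · refine .step (by simp [stmtOp, hf, StackOp.next])
          (((ih₁ h₁ _ _).1 v' e).mono (by omega))
      · refine HaltsIn.mono (.step (by simp [stmtOp, hf, StackOp.next])
          ((ih₁ h₁ _ _).2 l v' s₁ e h')) (by omega)
  | goto f =>
    refine ⟨fun v' e => by simp [TM2.stepAux] at e, fun l v' s₁ e h' => ?_⟩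
    simp only [TM2.stepAux, TM2.Cfg.mk.injEq, Option.some.injEq] at e
    obtain ⟨rfl, rfl, rfl⟩ := e
    exact .step rfl h'
  | halt =>
    refine ⟨fun v' e => ?_, fun l v' s₁ e h' => by simp [TM2.stepAux] at e⟩
    simp only [TM2.stepAux, TM2.Cfg.mk.injEq] at e
    obtain ⟨-, rfl, rfl⟩ := e
    exact .halt rfl

theorem iterate_bind_none {α : Type*} (f : α → Option α) (n : ℕ) :
    (flip bind f)^[n] none = none := by
  induction n with
  | zero => rfl
  | succ n ih => rw [iterate_succ_apply]; exact ih

/-- Each of the `n` steps of `TM2` unfolds to at most `D` operations. -/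
theorem haltsIn_of_iterate {D : ℕ} (hD : ∀ l, stmtSize (M l) ≤ D) (n : ℕ) (l : Λ) (v v' : σ)
    (s s' : Store Γ)
    (h : (flip bind (TM2.step M))^[n] (some ⟨some l, v, s⟩) = some ⟨none, v', s'⟩) :
    HaltsIn (fun x : Position M => stmtOp x.1.1 x.1.2 x.2) (⟨M l, l, TM2.stmts₁_self⟩, v) s s'
      (n * D) := by
  induction n generalizing l v s with
  | zero => simp at h
  | succ n ih =>
    rw [iterate_succ_apply] at h
    change (flip bind (TM2.step M))^[n] (some (TM2.stepAux (M l) v s)) = _ at h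
    rcases hc : TM2.stepAux (M l) v s with ⟨l', v₁, s₁⟩
    rw [hc] at h
    have hn : (n + 1) * D = n * D + D := by ring
    cases l' with
    | none =>
      -- A further step after halting would give `none`, and iteration never leaves `none`.
      have : n = 0 := by
        by_contra hn
        obtain ⟨m, rfl⟩ := Nat.exists_eq_succ_of_ne_zero hn
        rw [iterate_succ_apply] at h
        change (flip bind (TM2.step M))^[m] none = _ at h
        rw [iterate_bind_none] at h
        simp at h
      subst this
      simp only [iterate_zero, id_eq, Option.some.injEq, TM2.Cfg.mk.injEq] at h
      obtain ⟨-, -, rfl⟩ := h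
      exact ((haltsIn_stmt (M l) _ v s s₁ 0).1 v₁ hc).mono (by have := hD l; omega)
    | some l' =>
      exact ((haltsIn_stmt (M l) _ v s s' (n * D)).2 l' v₁ s₁ hc (ih _ _ _ h)).mono
        (by have := hD l; omega)

end OfTM2

namespace StackMachine

variable [DecidableEq K]

/-- The program of `TM2` for a stack machine. -/
def toStmt (P : StackMachine Γ) (q : P.S) : TM2.Stmt Γ P.S P.S :=
  match P.code q with
  | .push k a q' => .push k (fun _ => a) (.goto fun _ => q')
  -- The variable of the `TM2` program serves to store the next state, which depends on the popped
  -- symbol.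
  | .pop k f => .pop k (fun _ o => f o) (.goto id)
  | .peek k f => .peek k (fun _ o => f o) (.goto id)
  | .jump q' => .goto fun _ => q'
  -- `haltList` prescribes the initial value of the variable in the final configuration.
  | .halt => .load (fun _ => P.start) .halt

/-- The statement that halts is itself a step of `TM2`, whence `t + 1`. The value `v` is arbitrary
because it is always overwritten before it matters. -/
theorem iterate_toStmt {P : StackMachine Γ} {q : P.S} {s s' : Store Γ} {t : ℕ}
    (h : HaltsIn P.code q s s' t) (v : P.S) :
    ∃ n ≤ t + 1, (flip bind (TM2.step P.toStmt))^[n] (some ⟨some q, v, s⟩) =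
      some ⟨none, P.start, s'⟩ := by
  induction h generalizing v with
  | @halt q s t h =>
    refine ⟨1, by omega, ?_⟩
    rw [iterate_one]
    change some (TM2.stepAux (P.toStmt q) v s) = _
    cases hc : P.code q <;> simp_all [StackOp.next, toStmt]
  | @step q q' s s₁ s' t h _ ih =>
    obtain ⟨v', hv⟩ : ∃ v', TM2.stepAux (P.toStmt q) v s = ⟨some q', v', s₁⟩ := by
      cases hc : P.code q <;> rw [hc] at h <;>
        simp only [StackOp.next, Option.some.injEq, Prod.mk.injEq, reduceCtorEq] at h <;>
        obtain ⟨rfl, rfl⟩ := h <;> simp [toStmt, hc]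
    obtain ⟨n, hn, e⟩ := ih v'
    refine ⟨n + 1, by omega, ?_⟩
    rw [iterate_succ_apply, ← e]
    change (flip bind (TM2.step P.toStmt))^[n] (some (TM2.stepAux (P.toStmt q) v s)) = _
    rw [hv]

end StackMachine

/-- The stack `k` holds `l`, all others are empty. -/
def single [DecidableEq K] (k : K) (l : List (Γ k)) : Store Γ := update (fun _ => []) k l

/-- A stack machine that computes `f` in polynomial time, with respect to the encodings `ea` of the
input and `eb` of the output. -/
structure PolyTimeProgram {α β A B : Type} (ea : α → List A) (eb : β → List B) (f : α → β) where
  K : Type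
  [decK : DecidableEq K]
  [finK : Fintype K]
  Γ : K → Type
  k₀ : K
  k₁ : K
  input : Γ k₀ ≃ A
  output : Γ k₁ ≃ B
  machine : StackMachine Γ
  time : Polynomial ℕ
  runs : ∀ a, machine.Runs (single k₀ ((ea a).map input.symm)) (single k₁ ((eb (f a)).map output.symm))
    (time.eval (ea a).length)

attribute [instance] PolyTimeProgram.decK PolyTimeProgram.finK

namespace PolyTimeProgram

variable {α β A B : Type} {ea : α → List A} {eb : β → List B} {f : α → β}

theorem nonempty_of_tm2 (h : TM2ComputableInPolyTime ea eb f) :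
    Nonempty (PolyTimeProgram ea eb f) := by
  obtain ⟨⟨tm, i, o⟩, p, hp⟩ := h
  have := tm.σFin
  have := tm.ΛFin
  have := tm.kFin
  -- There are finitely many labels, each with finitely many substatements.
  have : Finite {q : TM2.Stmt tm.Γ tm.Λ tm.σ // ∃ l, q ∈ TM2.stmts₁ (tm.m l)} := by
    have : {q : TM2.Stmt tm.Γ tm.Λ tm.σ | ∃ l, q ∈ TM2.stmts₁ (tm.m l)} =
        ⋃ l, (TM2.stmts₁ (tm.m l) : Set _) := by ext; simp
    have h : {q : TM2.Stmt tm.Γ tm.Λ tm.σ | ∃ l, q ∈ TM2.stmts₁ (tm.m l)}.Finite := by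
      rw [this]; exact Set.finite_iUnion fun l => Finset.finite_toSet _
    exact h
  have : Fintype {q : TM2.Stmt tm.Γ tm.Λ tm.σ // ∃ l, q ∈ TM2.stmts₁ (tm.m l)} := Fintype.ofFinite _
  refine ⟨{
    K := tm.K, Γ := tm.Γ, k₀ := tm.k₀, k₁ := tm.k₁, input := i, output := o,
    machine :=
      { S := Position tm.m, start := (⟨tm.m tm.main, _, TM2.stmts₁_self⟩, tm.initialState),
        code := fun x => stmtOp x.1.1 x.1.2 x.2 },
    -- The sum of the sizes is a common bound for the size of one statement.
    time := p * Polynomial.C (∑ l, stmtSize (tm.m l)), runs := fun a => ?_ }⟩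
  obtain ⟨⟨n, hn⟩, hle⟩ := hp a
  have hinit : ∀ l, initList tm l = ⟨some tm.main, tm.initialState, single tm.k₀ l⟩ := by
    intro l
    simp only [initList, single]
    congr 1
    funext k
    by_cases hk : k = tm.k₀
    · subst hk; simp
    · simp [hk]
  have hhalt : ∀ l, haltList tm l = ⟨none, tm.initialState, single tm.k₁ l⟩ := by
    intro l
    simp only [haltList, single]
    congr 1
    funext k
    by_cases hk : k = tm.k₁
    · subst hk; simp
    · simp [hk]
  rw [hinit, Option.map_some, hhalt] at hn
  refine HaltsIn.mono (haltsIn_of_iterate (D := ∑ l, stmtSize (tm.m l))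
    (fun l => Finset.single_le_sum (f := fun l => stmtSize (tm.m l)) (fun _ _ => Nat.zero_le _)
      (Finset.mem_univ l)) n _ _ _ _ _ hn) ?_
  simp only [Polynomial.eval_mul, Polynomial.eval_C]
  exact Nat.mul_le_mul_right _ hle

theorem tm2 [Fintype A] (P : PolyTimeProgram ea eb f) : Nonempty (TM2ComputableInPolyTime ea eb f) := by
  have : Fintype (P.Γ P.k₀) := Fintype.ofEquiv _ P.input.symm
  let tm : FinTM2 :=
    { K := P.K, k₀ := P.k₀, k₁ := P.k₁, Γ := P.Γ, Λ := P.machine.S, main := P.machine.start,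
      σ := P.machine.S, initialState := P.machine.start, m := P.machine.toStmt }
  have hinit : ∀ l, initList tm l = ⟨some tm.main, tm.initialState, single P.k₀ l⟩ := by
    intro l
    simp only [initList, single]
    congr 1
    funext k
    by_cases hk : k = P.k₀
    · subst hk; simp [tm]
    · simp [hk, tm]
  have hhalt : ∀ l, haltList tm l = ⟨none, tm.initialState, single P.k₁ l⟩ := by
    intro l
    simp only [haltList, single]
    congr 1
    funext k
    by_cases hk : k = P.k₁
    · subst hk; simp [tm]
    · simp [hk, tm]
  refine ⟨{
    tm := tm, inputAlphabet := P.input, outputAlphabet := P.output, time := P.time + 1,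
    outputsFun := fun a => Classical.choice ?_ }⟩
  obtain ⟨n, hn, e⟩ := StackMachine.iterate_toStmt (P.runs a) P.machine.start
  refine ⟨⟨⟨n, ?_⟩, by simpa using hn⟩⟩
  rw [hinit, Option.map_some, hhalt]
  exact e

end PolyTimeProgram

end CVPV

namespace CVPV

open Function

namespace StackMachine

/-! ### Basic programs that empty, move and copy stacks. -/

section Programs

variable {K : Type} {Γ : K → Type} [DecidableEq K]

/-- Pop the symbols of the stack `k` one after the other, and run `g a` for each symbol `a`. -/
def forEach (k : K) [Fintype (Γ k)] (g : Γ k → StackMachine Γ) : StackMachine Γ :=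
  loop k fun
    | some a => (g a, true)
    | none => (skip, false)

/-- Move the contents of the stack `k` to the stack `k'`, in reverse order. -/
def move (k k' : K) [Fintype (Γ k)] (φ : Γ k → Γ k') : StackMachine Γ :=
  forEach k fun a => push k' (φ a)

/-- Push a word, the last letter first. -/
def pushAll (k : K) : List (Γ k) → StackMachine Γ
  | [] => skip
  | a :: l => (pushAll k l).seq (push k a)

variable {k : K} {s s' s'' : Store Γ} {t u : ℕ}

theorem Runs.of_eq {P : StackMachine Γ} {r r' : Store Γ} (h : P.Runs s s' t) (hr : r = s)
    (hr' : r' = s') (hu : t ≤ u) : P.Runs r r' u := by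
  subst hr hr'
  exact h.mono hu

theorem runs_pushAll (l : List (Γ k)) :
    (pushAll k l).Runs s (update s k (l ++ s k)) (2 * l.length) := by
  induction l with
  | nil => simpa [pushAll] using runs_skip
  | cons a l ih =>
    have := ih.seq (runs_push (k := k) (a := a))
    simp only [update_self, update_idem] at this
    exact this.mono (by simp; omega)

variable [Fintype (Γ k)] {g : Γ k → StackMachine Γ}

theorem runs_forEach_nil (h : s k = []) : (forEach k g).Runs s s 2 := by
  have : update s k (s k).tail = s := by rw [h, List.tail_nil, ← h, update_eq_self]
  refine runs_loop_of_stop (t := 0) (by simp [h]) ?_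
  rw [this, h]
  exact runs_skip

theorem runs_forEach_cons {a : Γ k} {l : List (Γ k)} (h : s k = a :: l)
    (ha : (g a).Runs (update s k l) s' t) (hl : (forEach k g).Runs s' s'' u) :
    (forEach k g).Runs s s'' (t + u + 2) := by
  refine runs_loop_of_continue (s' := s') (by simp [h]) ?_ hl
  simpa [h] using ha

theorem runs_clear (l : List (Γ k)) (hl : s k = l) :
    (forEach k fun _ => skip).Runs s (update s k []) (2 * l.length + 2) := by
  induction l generalizing s with
  | nil =>
    have e : update s k [] = s := by rw [← hl, update_eq_self]
    simpa [e] using runs_forEach_nil hl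
  | cons a l ih =>
    have := runs_forEach_cons (g := fun _ => skip) (t := 0) hl runs_skip (ih (update_self ..))
    rw [update_idem] at this
    exact this.mono (by simp; omega)

/-- A symbol costs its pop, its push and the jump back; the last two steps are the pop on the empty
stack and the exit. -/
theorem runs_move {k' : K} (hk : k' ≠ k) (φ : Γ k → Γ k') (l : List (Γ k)) (hl : s k = l) :
    (move k k' φ).Runs s (update (update s k []) k' ((l.map φ).reverse ++ s k'))
      (3 * l.length + 2) := by
  induction l generalizing s with
  | nil =>
    have e : update s k [] = s := by rw [← hl, update_eq_self]
    simpa [move, e] using runs_forEach_nil hl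
  | cons a l ih =>
    have := runs_forEach_cons (g := fun a => push k' (φ a)) hl runs_push
      (ih (s := update (update s k l) k' (φ a :: update s k l k'))
        (by rw [update_of_ne hk.symm, update_self]))
    convert this.mono (u := 3 * (a :: l).length + 2) (by simp; omega) using 1
    · rfl
    funext j
    by_cases hj₁ : j = k'
    · subst hj₁
      simp [hk]
    by_cases hj : j = k
    · subst hj
      simp [hj₁]
    · simp [hj, hj₁]

/-- This serves to hand the same input to two programs. -/
theorem runs_move_two {k₁ k₂ : K} (h₁ : k₁ ≠ k) (h₂ : k₂ ≠ k) (h₁₂ : k₁ ≠ k₂) (φ₁ : Γ k → Γ k₁)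
    (φ₂ : Γ k → Γ k₂) (l : List (Γ k)) (hl : s k = l) :
    (forEach k fun a => (push k₁ (φ₁ a)).seq (push k₂ (φ₂ a))).Runs s
      (update (update (update s k []) k₁ ((l.map φ₁).reverse ++ s k₁)) k₂
        ((l.map φ₂).reverse ++ s k₂)) (5 * l.length + 2) := by
  induction l generalizing s with
  | nil =>
    have e : update s k [] = s := by rw [← hl, update_eq_self]
    simpa [e] using runs_forEach_nil hl
  | cons a l ih =>
    have := runs_forEach_cons (g := fun a => (push k₁ (φ₁ a)).seq (push k₂ (φ₂ a))) hl
      (runs_push.seq runs_push)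
      (ih (by rw [update_of_ne h₂.symm, update_of_ne h₁.symm, update_self]))
    convert this.mono (u := 5 * (a :: l).length + 2) (by simp; omega) using 1
    funext j
    by_cases hj₂ : j = k₂
    · subst hj₂
      simp [h₂, h₁₂.symm]
    by_cases hj₁ : j = k₁
    · subst hj₁
      simp [h₁, h₁₂]
    by_cases hj : j = k
    · subst hj
      simp [hj₁, hj₂]
    · simp [hj, hj₁, hj₂]

/-- With `c` as the marker in front of every bit, this writes the self-delimiting part of
`pairCode`. The marker is pushed second because it is read first. -/
theorem runs_push_two {k' : K} (hk : k' ≠ k) (φ : Γ k → Γ k') (c : Γ k') (l : List (Γ k))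
    (hl : s k = l) :
    (forEach k fun a => (push k' (φ a)).seq (push k' c)).Runs s
      (update (update s k []) k' (l.reverse.flatMap (fun a => [c, φ a]) ++ s k'))
      (5 * l.length + 2) := by
  induction l generalizing s with
  | nil =>
    have e : update s k [] = s := by rw [← hl, update_eq_self]
    simpa [e] using runs_forEach_nil hl
  | cons a l ih =>
    have := runs_forEach_cons (g := fun a => (push k' (φ a)).seq (push k' c)) hl
      (runs_push.seq runs_push)
      (ih (by rw [update_of_ne hk.symm, update_of_ne hk.symm, update_self]))
    convert this.mono (u := 5 * (a :: l).length + 2) (by simp; omega) using 1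
    funext j
    by_cases hj₁ : j = k'
    · subst hj₁
      simp [hk]
    by_cases hj : j = k
    · subst hj
      simp [hj₁]
    · simp [hj, hj₁]

end Programs

end StackMachine

/-! ## Disjoint unions of collections of stacks -/

section Join

variable {K K' : Type} {Γ : K → Type} {Γ' : K' → Type}

/-- The alphabets of the stacks of two disjoint collections. -/
abbrev Stacks (Γ : K → Type) (Γ' : K' → Type) : K ⊕ K' → Type
  | .inl k => Γ k
  | .inr k => Γ' k

/-- Empty stacks. -/
def Store.nil : Store Γ := fun _ => []

theorem Store.nil_apply (k : K) : (Store.nil : Store Γ) k = [] := rfl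

/-- The stacks of two disjoint collections. -/
def join (s : Store Γ) (s' : Store Γ') : Store (Stacks Γ Γ')
  | .inl k => s k
  | .inr k => s' k

theorem join_inl (s : Store Γ) (s' : Store Γ') (k : K) : join s s' (.inl k) = s k := rfl

theorem join_inr (s : Store Γ) (s' : Store Γ') (k : K') : join s s' (.inr k) = s' k := rfl

theorem join_nil : join (Store.nil : Store Γ) (Store.nil : Store Γ') = Store.nil := by
  funext k; cases k <;> rfl

variable [DecidableEq K] [DecidableEq K']

theorem update_nil (k : K) (l : List (Γ k)) : update Store.nil k l = single k l := rfl

theorem single_self (k : K) (l : List (Γ k)) : single k l k = l := update_self ..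

theorem update_single (k : K) (l l' : List (Γ k)) : update (single k l) k l' = single k l' :=
  update_idem ..

theorem single_nil (k : K) : single k ([] : List (Γ k)) = Store.nil := update_eq_self ..

theorem update_join_inl (s : Store Γ) (s' : Store Γ') (k : K) (l : List (Γ k)) :
    update (join s s') (.inl k) l = join (update s k l) s' := by
  funext j
  obtain j | j := j
  · by_cases hj : j = k
    · subst hj
      exact (update_self ..).trans (update_self (β := fun k => List (Γ k)) ..).symm
    · exact (update_of_ne (by simpa using hj) _ _).trans
        (update_of_ne (β := fun k => List (Γ k)) hj _ _).symm
  · exact update_of_ne (by simp) _ _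

theorem update_join_inr (s : Store Γ) (s' : Store Γ') (k : K') (l : List (Γ' k)) :
    update (join s s') (.inr k) l = join s (update s' k l) := by
  funext j
  obtain j | j := j
  · exact update_of_ne (by simp) _ _
  · by_cases hj : j = k
    · subst hj
      exact (update_self ..).trans (update_self (β := fun k => List (Γ' k)) ..).symm
    · exact (update_of_ne (by simpa using hj) _ _).trans
        (update_of_ne (β := fun k => List (Γ' k)) hj _ _).symm

theorem single_inl (k : K) (l : List (Γ k)) :
    single (Γ := Stacks Γ Γ') (.inl k) l = join (single k l) Store.nil := by
  rw [← update_nil, ← join_nil, update_join_inl, update_nil]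

theorem single_inr (k : K') (l : List (Γ' k)) :
    single (Γ := Stacks Γ Γ') (.inr k) l = join Store.nil (single k l) := by
  rw [← update_nil, ← join_nil, update_join_inr, update_nil]

namespace StackMachine

/-- A machine on the left part of the stacks. -/
def inl (Γ' : K' → Type) (P : StackMachine Γ) : StackMachine (Stacks Γ Γ') :=
  P.lift (Γ' := Stacks Γ Γ') Sum.inl

/-- A machine on the right part of the stacks. -/
def inr (Γ : K → Type) (P : StackMachine Γ') : StackMachine (Stacks Γ Γ') :=
  P.lift (Γ' := Stacks Γ Γ') Sum.inr

theorem Runs.inl {P : StackMachine Γ} {s s' : Store Γ} {t : ℕ} (h : P.Runs s s' t)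
    (r : Store Γ') : (P.inl Γ').Runs (join s r) (join s' r) t :=
  Runs.lift (Γ' := Stacks Γ Γ') (κ := Sum.inl) Sum.inl_injective h fun k' hk => by
    obtain k' | k' := k'
    · exact absurd rfl (hk k')
    · rfl

theorem Runs.inr {P : StackMachine Γ'} {s s' : Store Γ'} {t : ℕ} (h : P.Runs s s' t)
    (r : Store Γ) : (P.inr Γ).Runs (join r s) (join r s') t :=
  Runs.lift (Γ' := Stacks Γ Γ') (κ := Sum.inr) Sum.inr_injective h fun k' hk => by
    obtain k' | k' := k'
    · rfl
    · exact absurd rfl (hk k')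

end StackMachine

end Join

theorem polynomial_eval_mono (q : Polynomial ℕ) : Monotone fun n => q.eval n := by
  intro m n h
  simp only [Polynomial.eval_eq_sum, Polynomial.sum]
  gcongr

/-! ### Composition, pairing and constants for polynomial-time programs. -/

namespace PolyTimeProgram

open StackMachine

variable {α β γ A B C : Type} {ea : α → List A} {eb : β → List B} {ec : γ → List C}
  {f : α → β} {g : β → γ}

/-- The second program of a composition runs on an input of this length, so its time stays
polynomial. -/
theorem length_le (P : PolyTimeProgram ea eb f) (a : α) :
    (eb (f a)).length ≤ (ea a).length + P.time.eval (ea a).length := by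
  have h := HaltsIn.length_le (P.runs a) P.k₁
  rw [single_self, List.length_map] at h
  refine h.trans (Nat.add_le_add_right ?_ _)
  -- The output stack may coincide with the input stack, which is not empty at the start.
  by_cases hk : P.k₁ = P.k₀
  · have : ∀ k, (single P.k₀ ((ea a).map P.input.symm) k).length ≤ (ea a).length := by
      intro k
      by_cases hk : k = P.k₀
      · subst hk; simp [single_self]
      · simp [single, hk]
    exact this _
  · simp [single, hk]

/-- The composition of two polynomial-time programs. -/
noncomputable def comp [Fintype B] (Q : PolyTimeProgram eb ec g) (P : PolyTimeProgram ea eb f) :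
    PolyTimeProgram ea ec (g ∘ f) :=
  let Γ := Stacks P.Γ (Stacks Q.Γ fun _ : Unit => B)
  haveI : Fintype (Γ (.inl P.k₁)) := Fintype.ofEquiv B P.output.symm
  haveI : Fintype (Γ (.inr (.inr ()))) := ‹Fintype B›
  { K := P.K ⊕ (Q.K ⊕ Unit)
    Γ := Γ
    k₀ := .inl P.k₀
    k₁ := .inr (.inl Q.k₁)
    input := P.input
    output := Q.output
    -- A move reverses the word, so the intermediate result takes two moves through an auxiliary
    -- stack.
    machine := (P.machine.inl _).seq <|
      (move (Γ := Γ) (.inl P.k₁) (.inr (.inr ())) P.output).seq <|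
      (move (Γ := Γ) (.inr (.inr ())) (.inr (.inl Q.k₀)) Q.input.symm).seq
      ((Q.machine.inl _).inr _)
    -- The intermediate word has length at most `X + P.time`, and each of the two moves costs 3
    -- steps per symbol.
    time := 7 * P.time + 6 * Polynomial.X + 7 + Q.time.comp (Polynomial.X + P.time)
    runs a := by
      have h₁ := (P.runs a).inl (join (Store.nil : Store Q.Γ) (Store.nil : Store fun _ : Unit => B))
      have h₂ := runs_move (Γ := Γ) (k := .inl P.k₁) (k' := .inr (.inr ())) (by simp) P.output _
        (s := join (single P.k₁ ((eb (f a)).map P.output.symm))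
          (join (Store.nil : Store Q.Γ) (Store.nil : Store fun _ : Unit => B))) rfl
      simp only [join_inl, join_inr, update_join_inl, update_join_inr, update_single, single_self,
        single_nil, Store.nil_apply, update_nil] at h₂
      have h₃ := runs_move (Γ := Γ) (k := .inr (.inr ())) (k' := .inr (.inl Q.k₀)) (by simp)
        Q.input.symm _ (s := join (Store.nil : Store P.Γ)
          (join (Store.nil : Store Q.Γ) (single () (eb (f a)).reverse))) rfl
      simp only [join_inl, join_inr, update_join_inl, update_join_inr, update_single, single_self,
        single_nil, Store.nil_apply, update_nil] at h₃
      have h₄ := ((Q.runs (f a)).inl (Store.nil : Store fun _ : Unit => B)).inr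
        (Store.nil : Store P.Γ)
      rw [List.map_map, Equiv.self_comp_symm, List.map_id, List.append_nil] at h₂
      rw [List.map_reverse, List.reverse_reverse, List.append_nil] at h₃
      refine Runs.of_eq (h₁.seq (h₂.seq (h₃.seq h₄))) ((single_inl _ _).trans (by rw [join_nil]))
        ((single_inr _ _).trans (congrArg _ (single_inl _ _))) ?_
      have hlen := P.length_le a
      have hmono := polynomial_eval_mono Q.time hlen
      simp only [List.length_map, List.length_reverse, Polynomial.eval_add, Polynomial.eval_mul,
        Polynomial.eval_ofNat, Polynomial.eval_X, Polynomial.eval_comp] at hmono ⊢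
      omega }

/-- Run two programs on the same input. -/
noncomputable def pair [Fintype A] {f g : α → Str} (P : PolyTimeProgram ea id f)
    (Q : PolyTimeProgram ea id g) : PolyTimeProgram ea id fun a => pairCode (f a) (g a) :=
  let Γ := Stacks P.Γ (Stacks Q.Γ (Stacks (fun _ : Unit => A) fun _ : Unit => Bool))
  haveI : Fintype (Γ (.inr (.inl Q.k₀))) := Fintype.ofEquiv A Q.input.symm
  haveI : Fintype (Γ (.inl P.k₁)) := Fintype.ofEquiv Bool P.output.symm
  haveI : Fintype (Γ (.inr (.inr (.inl ())))) := ‹Fintype A›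
  haveI : Fintype (Γ (.inr (.inr (.inr ())))) := inferInstanceAs (Fintype Bool)
  { K := P.K ⊕ (Q.K ⊕ (Unit ⊕ Unit))
    Γ := Γ
    k₀ := .inr (.inl Q.k₀)
    k₁ := .inr (.inl Q.k₁)
    input := Q.input
    output := Q.output
    -- After both runs, the pair is built from right to left on top of the output of `Q`: the end
    -- marker `false` is pushed first, then the bits of the other output, the last one first, each
    -- topped by `true`.
    machine := (move (Γ := Γ) (.inr (.inl Q.k₀)) (.inr (.inr (.inl ()))) Q.input).seq <|
      (forEach (Γ := Γ) (.inr (.inr (.inl ()))) fun a =>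
        (push (.inl P.k₀) (P.input.symm a)).seq (push (.inr (.inl Q.k₀)) (Q.input.symm a))).seq <|
      (P.machine.inl _).seq <|
      ((Q.machine.inl _).inr _).seq <|
      (push (Γ := Γ) (.inr (.inl Q.k₁)) (Q.output.symm false)).seq <|
      (move (Γ := Γ) (.inl P.k₁) (.inr (.inr (.inr ()))) P.output).seq <|
      (forEach (Γ := Γ) (.inr (.inr (.inr ()))) fun x =>
        (push (.inr (.inl Q.k₁)) (Q.output.symm x)).seq
          (push (.inr (.inl Q.k₁)) (Q.output.symm true)))
    time := 16 * Polynomial.X + 9 * P.time + Q.time + 15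
    runs a := by
      have h₁ := runs_move (Γ := Γ) (k := .inr (.inl Q.k₀)) (k' := .inr (.inr (.inl ())))
        (by simp) Q.input _ (s := join (Store.nil : Store P.Γ)
          (join (single Q.k₀ ((ea a).map Q.input.symm)) (join Store.nil Store.nil))) rfl
      have h₂ := runs_move_two (Γ := Γ) (k := .inr (.inr (.inl ()))) (k₁ := .inl P.k₀)
        (k₂ := .inr (.inl Q.k₀)) (by simp) (by simp) (by simp) P.input.symm Q.input.symm _
        (s := join (Store.nil : Store P.Γ) (join (Store.nil : Store Q.Γ)
          (join (single () (ea a).reverse) Store.nil))) rfl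
      have h₃ := (P.runs a).inl (join (single Q.k₀ ((ea a).map Q.input.symm))
        (join (Store.nil : Store fun _ : Unit => A) (Store.nil : Store fun _ : Unit => Bool)))
      have h₄ := ((Q.runs a).inl (join (Store.nil : Store fun _ : Unit => A)
        (Store.nil : Store fun _ : Unit => Bool))).inr (single P.k₁ ((f a).map P.output.symm))
      have h₅ := runs_push (Γ := Γ) (k := .inr (.inl Q.k₁)) (a := Q.output.symm false)
        (s := join (single P.k₁ ((f a).map P.output.symm))
          (join (single Q.k₁ ((g a).map Q.output.symm)) (join Store.nil Store.nil)))
      have h₆ := runs_move (Γ := Γ) (k := .inl P.k₁) (k' := .inr (.inr (.inr ())))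
        (by simp) P.output _ (s := join (single P.k₁ ((f a).map P.output.symm))
          (join (single Q.k₁ ((false :: g a).map Q.output.symm)) (join Store.nil Store.nil))) rfl
      have h₇ := runs_push_two (Γ := Γ) (k := .inr (.inr (.inr ()))) (k' := .inr (.inl Q.k₁))
        (by simp) Q.output.symm (Q.output.symm true) _ (s := join (Store.nil : Store P.Γ)
          (join (single Q.k₁ ((false :: g a).map Q.output.symm))
            (join Store.nil (single () (f a).reverse)))) rfl
      simp only [join_inl, join_inr, update_join_inl, update_join_inr, update_single, single_self,
        single_nil, Store.nil_apply, update_nil, List.map_map, Equiv.self_comp_symm, List.map_id,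
        List.append_nil, List.reverse_reverse, List.map_reverse] at h₁ h₂ h₅ h₆ h₇
      have hout : List.flatMap (fun x => [Q.output.symm true, Q.output.symm x]) (f a) ++
          List.map Q.output.symm (false :: g a) = (pairCode (f a) (g a)).map Q.output.symm := by
        simp [pairCode, List.map_flatMap]
      rw [hout] at h₇
      refine Runs.of_eq (h₁.seq (h₂.seq (h₃.seq (h₄.seq (h₅.seq (h₆.seq h₇))))))
        ((single_inr _ _).trans (congrArg _ ((single_inl _ _).trans (by rw [join_nil]))))
        ((single_inr _ _).trans (congrArg _ ((single_inl _ _).trans (by rw [join_nil]; rfl)))) ?_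
      have hlen := P.length_le a
      simp only [List.length_map, List.length_reverse, Polynomial.eval_add, Polynomial.eval_mul,
        Polynomial.eval_ofNat, Polynomial.eval_X, id_eq] at hlen ⊢
      omega }

/-- Erase the input and write a fixed word. -/
noncomputable def const [Fintype A] (b : β) : PolyTimeProgram ea eb fun _ => b :=
  let Γ := Stacks (fun _ : Unit => A) fun _ : Unit => B
  haveI : Fintype (Γ (.inl ())) := ‹Fintype A›
  { K := Unit ⊕ Unit
    Γ := Γ
    k₀ := .inl ()
    k₁ := .inr ()
    input := .refl A
    output := .refl B
    machine := (forEach (Γ := Γ) (.inl ()) fun _ => skip).seq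
      (pushAll (Γ := Γ) (.inr ()) (eb b))
    time := 2 * Polynomial.X + Polynomial.C (2 * (eb b).length + 3)
    runs a := by
      have h₁ := runs_clear (Γ := Γ) (k := .inl ()) _ (s := join (single () (ea a)) Store.nil) rfl
      have h₂ := runs_pushAll (Γ := Γ) (k := .inr ()) (eb b) (s := join Store.nil Store.nil)
      simp only [join_inl, join_inr, update_join_inl, update_join_inr, update_single, single_self,
        single_nil, Store.nil_apply, update_nil, List.append_nil] at h₁ h₂
      refine Runs.of_eq (h₁.seq h₂)
        ((congrArg _ (List.map_id _)).trans (single_inl _ _))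
        ((congrArg _ (List.map_id _)).trans (single_inr _ _)) ?_
      simp only [Polynomial.eval_add, Polynomial.eval_mul, Polynomial.eval_ofNat,
        Polynomial.eval_X, Polynomial.eval_C]
      omega }

end PolyTimeProgram

end CVPV

namespace CVPV

open Function

namespace StackMachine

section

variable {K : Type} {Γ : K → Type} [DecidableEq K] {k : K} [Fintype (Γ k)]
  {body : Option (Γ k) → StackMachine Γ × Bool} {s s' s'' : Store Γ} {t u : ℕ}

theorem runs_loop_stop {a : Γ k} {l : List (Γ k)} (hs : s k = a :: l)
    (h : (body (some a)).1.Runs (update s k l) s' t) (hb : (body (some a)).2 = false) :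
    (loop k body).Runs s s' (t + 2) :=
  runs_loop_of_stop (by simpa [hs] using hb) (by simpa [hs] using h)

theorem runs_loop_continue {a : Γ k} {l : List (Γ k)} (hs : s k = a :: l)
    (h : (body (some a)).1.Runs (update s k l) s' t) (hb : (body (some a)).2 = true)
    (h' : (loop k body).Runs s' s'' u) : (loop k body).Runs s s'' (t + u + 2) :=
  runs_loop_of_continue (s' := s') (by simpa [hs] using hb) (by simpa [hs] using h) h'

theorem runs_loop_nil (hs : s k = []) (h : (body none).1.Runs s s' t)
    (hb : (body none).2 = false) : (loop k body).Runs s s' (t + 2) := by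
  have : update s k (s k).tail = s := by rw [hs, List.tail_nil, ← hs, update_eq_self]
  exact runs_loop_of_stop (by simpa [hs] using hb) (by rw [this]; simpa [hs] using h)

end

end StackMachine

/-! ## Programs that rewrite a list of strings -/

theorem tape_nil : tape [] = [] := rfl

theorem tape_cons (y : Str) (l : List Str) : tape (y :: l) = y.map some ++ none :: tape l := by
  simp [tape]

theorem tape_append (l l' : List Str) : tape (l ++ l') = tape l ++ tape l' := by
  simp [tape]

/-- The stacks of the programs in this section. -/
inductive Reg
  | inp | out | aux | buf
  deriving DecidableEq

instance : Fintype Reg := ⟨{.inp, .out, .aux, .buf}, fun k => by cases k <;> simp⟩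

/-- Their alphabets. -/
abbrev RegAlphabet : Reg → Type := fun _ => Option Bool

/-- Stacks with the given contents. -/
def regs (i o a b : List (Option Bool)) : Store RegAlphabet
  | .inp => i
  | .out => o
  | .aux => a
  | .buf => b

section Regs

variable (i o a b l : List (Option Bool))

theorem regs_inp : regs i o a b .inp = i := rfl
theorem regs_out : regs i o a b .out = o := rfl

theorem update_regs_inp : update (regs i o a b) .inp l = regs l o a b := by
  funext k; cases k <;> rfl

theorem update_regs_out : update (regs i o a b) .out l = regs i l a b := by
  funext k; cases k <;> rfl

theorem update_regs_aux : update (regs i o a b) .aux l = regs i o l b := by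
  funext k; cases k <;> rfl

theorem update_regs_buf : update (regs i o a b) .buf l = regs i o a l := by
  funext k; cases k <;> rfl

theorem single_inp : single (Γ := RegAlphabet) .inp l = regs l [] [] [] := by
  funext k; cases k <;> rfl

end Regs

namespace StackMachine

variable {i o a b : List (Option Bool)}

theorem runs_push_out {x : Option Bool} :
    (push (Γ := RegAlphabet) .out x).Runs (regs i o a b) (regs i (x :: o) a b) 1 := by
  have := runs_push (Γ := RegAlphabet) (k := .out) (a := x) (s := regs i o a b)
  rwa [update_regs_out] at this

theorem runs_push_aux {x : Option Bool} :
    (push (Γ := RegAlphabet) .aux x).Runs (regs i o a b) (regs i o (x :: a) b) 1 := by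
  have := runs_push (Γ := RegAlphabet) (k := .aux) (a := x) (s := regs i o a b)
  rwa [update_regs_aux] at this

theorem runs_move_out_inp :
    (move (Γ := RegAlphabet) .out .inp id).Runs (regs i o a b) (regs (o.reverse ++ i) [] a b)
      (3 * o.length + 2) := by
  have := runs_move (Γ := RegAlphabet) (k := .out) (k' := .inp) (by simp) id o
    (s := regs i o a b) rfl
  rwa [update_regs_out, update_regs_inp, List.map_id] at this

theorem runs_move_aux_buf :
    (move (Γ := RegAlphabet) .aux .buf id).Runs (regs i o a b) (regs i o [] (a.reverse ++ b))
      (3 * a.length + 2) := by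
  have := runs_move (Γ := RegAlphabet) (k := .aux) (k' := .buf) (by simp) id a
    (s := regs i o a b) rfl
  rwa [update_regs_aux, update_regs_buf, List.map_id] at this

theorem runs_move_buf_out :
    (move (Γ := RegAlphabet) .buf .out id).Runs (regs i o a b) (regs i (b.reverse ++ o) a [])
      (3 * b.length + 2) := by
  have := runs_move (Γ := RegAlphabet) (k := .buf) (k' := .out) (by simp) id b
    (s := regs i o a b) rfl
  rwa [update_regs_buf, update_regs_out, List.map_id] at this

/-- Copy one string of the input to the output. -/
def copyString : StackMachine RegAlphabet :=
  loop (Γ := RegAlphabet) .inp fun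
    | some (some x) => (push .out (some x), true)
    | some none => (push .out none, false)
    | none => (skip, false)

theorem runs_copyString_cons (y : Str) :
    copyString.Runs (regs (y.map some ++ none :: i) o a b)
      (regs i (none :: (y.map some).reverse ++ o) a b) (3 * y.length + 3) := by
  induction y generalizing o with
  | nil =>
    refine runs_loop_stop (t := 1) rfl ?_ rfl
    rw [update_regs_inp]
    exact runs_push_out
  | cons x y ih =>
    refine (runs_loop_continue (t := 1) rfl ?_ rfl (ih (o := some x :: o))).of_eq rfl ?_ ?_
    · rw [update_regs_inp]
      exact runs_push_out
    · simp
    · simp; omega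

/-- Polynomial time concerns functions on all lists, so the programs must also be correct on lists
too short to come from a protocol. -/
theorem runs_copyString (l : List Str) :
    copyString.Runs (regs (tape l) o a b)
      (regs (tape (l.drop 1)) ((tape (l.take 1)).reverse ++ o) a b) (3 * (tape l).length + 3) := by
  cases l with
  | nil => exact (runs_loop_nil rfl (t := 0) runs_skip rfl).mono (by omega)
  | cons y l =>
    rw [tape_cons]
    refine (runs_copyString_cons y).of_eq rfl ?_ ?_
    · simp [tape_cons, tape_nil]
    · simp

/-- Copy two strings of the input to the output. -/
def copyTwo : StackMachine RegAlphabet := copyString.seq copyString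

theorem tape_drop_length_le (l : List Str) (n : ℕ) :
    (tape (l.drop n)).length ≤ (tape l).length := by
  conv_rhs => rw [← List.take_append_drop n l, tape_append]
  simp

theorem runs_copyTwo (l : List Str) :
    copyTwo.Runs (regs (tape l) o a b)
      (regs (tape (l.drop 2)) ((tape (l.take 2)).reverse ++ o) a b)
      (6 * (tape l).length + 7) := by
  refine ((runs_copyString l).seq (runs_copyString (l.drop 1))).of_eq rfl ?_ ?_
  · rw [← List.append_assoc, ← List.reverse_append, ← tape_append, List.drop_drop,
      ← List.take_add]
  · have := tape_drop_length_le l 1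
    omega

/-! ### Doubling the replies -/

/-- Write each of the remaining strings twice. -/
def doubleStrings : StackMachine RegAlphabet :=
  forEach (Γ := RegAlphabet) .inp fun
    | some x => (push .out (some x)).seq (push .aux (some x))
    | none => (push .out none).seq ((move (Γ := RegAlphabet) .aux .buf id).seq
        ((move (Γ := RegAlphabet) .buf .out id).seq (push .out none)))

/-- The loop does not stop between strings, so the rest of the run enters as the hypothesis `h`. The
stack `aux` keeps a second copy `a` of the letters read so far; at the separator it is moved to
`out` through `buf` to preserve the order, which costs 6 steps per letter. -/
theorem runs_doubleStrings_cons (y : Str) {s : Store RegAlphabet} {u : ℕ}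
    (h : doubleStrings.Runs
      (regs i (none :: ((y.map some).reverse ++ (a ++ none :: ((y.map some).reverse ++ o)))) [] [])
      s u) :
    doubleStrings.Runs (regs (y.map some ++ none :: i) o a []) s
      (u + 11 * y.length + 6 * a.length + 11) := by
  unfold doubleStrings at *
  induction y generalizing o a with
  | nil =>
    refine (runs_forEach_cons (Γ := RegAlphabet) (k := .inp) (a := none) (l := i) rfl ?_ h).mono
      (t := (1 + ((3 * a.length + 2) + ((3 * a.length + 2) + 1 + 1) + 1) + 1) + u + 2)
      (by simp only [List.length_nil]; omega)
    rw [update_regs_inp]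
    refine runs_push_out.seq (runs_move_aux_buf.seq (Runs.seq
      (t := 3 * a.length + 2) (u := 1) (runs_move_buf_out.of_eq rfl rfl ?_)
      (runs_push_out.of_eq ?_ rfl le_rfl)))
    · simp
    · simp
  | cons x y ih =>
    have := ih (o := some x :: o) (a := some x :: a) (by simpa using h)
    refine (runs_forEach_cons (Γ := RegAlphabet) (k := .inp) (a := some x) rfl ?_ this).mono
      (t := 1 + 1 + 1 + _ + 2) ?_
    · rw [update_regs_inp]
      exact runs_push_out.seq runs_push_aux
    · simp; omega

theorem runs_doubleStrings (l : List Str) :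
    doubleStrings.Runs (regs (tape l) o [] [])
      (regs [] ((tape (heardByBoth l)).reverse ++ o) [] []) (11 * (tape l).length + 2) := by
  induction l generalizing o with
  | nil => exact runs_forEach_nil rfl
  | cons y l ih =>
    rw [tape_cons]
    refine (runs_doubleStrings_cons y ih).of_eq rfl ?_ ?_
    · simp [heardByBoth, tape_cons]
    · simp; omega

/-! ### Encoding the first rows of a view -/

/-- Count the letters of one string of the input. -/
def countString : StackMachine RegAlphabet :=
  loop (Γ := RegAlphabet) .inp fun
    | some (some _) => (push .aux none, true)
    | some none => (skip, false)
    | none => (skip, false)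

theorem runs_countString_cons (y : Str) :
    countString.Runs (regs (y.map some ++ none :: i) o a b)
      (regs i o (List.replicate y.length none ++ a) b) (3 * y.length + 2) := by
  induction y generalizing a with
  | nil =>
    refine runs_loop_stop (t := 0) rfl ?_ rfl
    rw [update_regs_inp]
    exact runs_skip
  | cons x y ih =>
    refine (runs_loop_continue (t := 1) rfl ?_ rfl (ih (a := none :: a))).of_eq rfl ?_ ?_
    · rw [update_regs_inp]
      exact runs_push_aux
    · simp [List.replicate_succ', List.append_assoc]
    · simp; omega

theorem runs_countString (l : List Str) :
    countString.Runs (regs (tape l) o [] b)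
      (regs (tape (l.drop 1)) o (List.replicate (l.headD []).length none) b)
      (3 * (tape l).length + 2) := by
  cases l with
  | nil => exact (runs_loop_nil rfl (t := 0) runs_skip rfl).mono (by omega)
  | cons y l =>
    rw [tape_cons]
    refine (runs_countString_cons y).of_eq rfl ?_ ?_
    · simp
    · simp

/-- Write the code of the first component of a pair. -/
def codeFirst : StackMachine RegAlphabet :=
  loop (Γ := RegAlphabet) .inp fun
    | some (some x) => ((push .out (some true)).seq (push .out (some x)), true)
    | some none => (push .out (some false), false)
    | none => (skip, false)

theorem runs_codeFirst (y : Str) :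
    codeFirst.Runs (regs (y.map some ++ none :: i) o a b)
      (regs i (((pairCode y []).map some).reverse ++ o) a b) (5 * y.length + 3) := by
  induction y generalizing o with
  | nil =>
    refine runs_loop_stop (t := 1) rfl ?_ rfl
    rw [update_regs_inp]
    exact runs_push_out
  | cons x y ih =>
    refine (runs_loop_continue (t := 1 + 1 + 1) rfl ?_ rfl
      (ih (o := some x :: some true :: o))).of_eq rfl ?_ ?_
    · rw [update_regs_inp]
      exact runs_push_out.seq runs_push_out
    · simp [pairCode]
    · simp; omega

/-- Write one string without its first letter. -/
def copyTail : StackMachine RegAlphabet :=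
  loop (Γ := RegAlphabet) .inp fun
    | some (some _) => (copyString, false)
    | some none => (push .out none, false)
    | none => (push .out none, false)

/-- The letter dropped is the bit that marks a known message in a view. If no string is left, a lone
separator is written, in agreement with `headD []`. -/
theorem runs_copyTail (l : List Str) :
    copyTail.Runs (regs (tape l) o a b)
      (regs (tape l.tail) (none :: (((l.headD []).tail.map some).reverse ++ o)) a b)
      (3 * (tape l).length + 3) := by
  match l with
  | [] =>
    exact (runs_loop_nil rfl (t := 1) runs_push_out rfl).mono (by omega)
  | [] :: l =>
    rw [tape_cons]
    refine (runs_loop_stop (t := 1) rfl ?_ rfl).mono (by simp)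
    rw [update_regs_inp]
    exact runs_push_out
  | (x :: y) :: l =>
    rw [tape_cons]
    refine (runs_loop_stop (t := 3 * y.length + 3) rfl ?_ rfl).mono ?_
    · rw [update_regs_inp]
      exact (runs_copyString_cons (o := o) y).of_eq rfl (by simp) le_rfl
    · simp; omega

/-- Write the code of a pair of strings, both without their first letters. -/
def codePair : StackMachine RegAlphabet :=
  loop (Γ := RegAlphabet) .inp fun
    | some (some _) => (codeFirst.seq copyTail, false)
    | some none => ((push .out (some false)).seq copyTail, false)
    | none => (skip, false)

end StackMachine

/-- The codes of the first `k` pairs in a list of strings without their first letters. -/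
def pairTails : ℕ → List Str → List Str
  | 0, _ => []
  | _ + 1, [] => []
  | k + 1, y :: l => pairCode y.tail (l.headD []).tail :: pairTails k l.tail

namespace StackMachine

variable {i o a b : List (Option Bool)}

theorem runs_codePair (y : Str) (l : List Str) :
    codePair.Runs (regs (tape (y :: l)) o a b)
      (regs (tape l.tail) ((tape [pairCode y.tail (l.headD []).tail]).reverse ++ o) a b)
      (5 * (tape (y :: l)).length + 10) := by
  rw [tape_cons]
  match y with
  | [] =>
    refine (runs_loop_stop (t := 1 + (3 * (tape l).length + 3) + 1) rfl ?_ rfl).mono ?_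
    · rw [update_regs_inp]
      refine (runs_push_out.seq (runs_copyTail l)).of_eq rfl ?_ le_rfl
      simp [tape, pairCode]
    · simp; omega
  | x :: y =>
    refine (runs_loop_stop (t := 5 * y.length + 3 + (3 * (tape l).length + 3) + 1) rfl ?_ rfl).mono ?_
    · rw [update_regs_inp]
      refine ((runs_codeFirst y).seq (runs_copyTail l)).of_eq rfl ?_ le_rfl
      simp [tape, pairCode]
    · simp; omega

/-- Write the code of a pair for each symbol on the stack `aux`. -/
def codePairs : StackMachine RegAlphabet :=
  forEach (Γ := RegAlphabet) .aux fun _ => codePair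

/-- The input only shrinks, so one bound `N` gives the same cost for every pair. The unread strings
`l'` are erased later. -/
theorem runs_codePairs (k N : ℕ) (l : List Str) (hN : (tape l).length ≤ N) :
    ∃ l', codePairs.Runs (regs (tape l) o (List.replicate k none) b)
        (regs (tape l') ((tape (pairTails k l)).reverse ++ o) [] b) (k * (5 * N + 12) + 2) := by
  unfold codePairs at *
  induction k generalizing l o with
  | zero => exact ⟨l, (runs_forEach_nil rfl).mono (by omega)⟩
  | succ k ih =>
    cases l with
    | nil =>
      obtain ⟨l', h⟩ := ih (o := o) [] hN
      refine ⟨l', (runs_forEach_cons (Γ := RegAlphabet) (k := .aux) (a := none)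
        (l := List.replicate k none) rfl (t := 2) ?_ h).of_eq rfl ?_ ?_⟩
      · rw [update_regs_aux]
        exact runs_loop_nil rfl (t := 0) runs_skip rfl
      · cases k <;> rfl
      · ring_nf; omega
    | cons y l =>
      obtain ⟨l', h⟩ := ih (o := (tape [pairCode y.tail (l.headD []).tail]).reverse ++ o)
        l.tail (by
          have := tape_drop_length_le (y :: l) 2
          rw [List.drop_succ_cons, List.drop_one] at this
          omega)
      refine ⟨l', (runs_forEach_cons (Γ := RegAlphabet) (k := .aux) (a := none)
        (l := List.replicate k none) rfl (t := 5 * N + 10) ?_ h).of_eq rfl ?_ ?_⟩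
      · rw [update_regs_aux]
        exact (runs_codePair y l).mono (by omega)
      · rw [pairTails, ← List.append_assoc, ← List.reverse_append, ← tape_append]
        rfl
      · ring_nf; omega

end StackMachine

/-- Write every string twice, apart from the first two. -/
def doubleReplies (l : List Str) : List Str := l.take 2 ++ heardByBoth (l.drop 2)

/-- Drop the third string `1ⁱ`, and replace the first `i + 1` pairs after it by the codes of their
tails. -/
def encodeView (l : List Str) : List Str :=
  -- The reply number `i` depends on the messages of the rounds `0, …, i`, hence `i + 1` pairs.
  l.take 2 ++ pairTails (((l.drop 2).headD []).length + 1) (l.drop 3)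

/-! ### Programs for the two rewritings. -/

namespace PolyTimeProgram

open StackMachine

/-- A program for the stacks `Reg` that leaves its reversed output on the stack `out`, and possibly
rubbish on the stack `inp`. -/
noncomputable def ofRegs (f : List Str → List Str) (P : StackMachine RegAlphabet)
    (p : Polynomial ℕ)
    (h : ∀ l, ∃ i, P.Runs (regs (tape l) [] [] []) (regs i (tape (f l)).reverse [] [])
      (p.eval (tape l).length)) : PolyTimeProgram tape tape f where
  K := Reg
  Γ := RegAlphabet
  k₀ := .inp
  k₁ := .inp
  input := .refl _
  output := .refl _
  machine := P.seq ((forEach (Γ := RegAlphabet) .inp fun _ => skip).seq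
    (move (Γ := RegAlphabet) .out .inp id))
  -- The rubbish has length at most `X + p` and the output at most `p`; erasing costs 2 steps per
  -- symbol and moving 3.
  time := 6 * p + 2 * Polynomial.X + 6
  runs l := by
    obtain ⟨i, hi⟩ := h l
    have h₁ := HaltsIn.length_le hi .inp
    have h₂ := HaltsIn.length_le hi .out
    rw [regs_inp, regs_inp] at h₁
    rw [regs_out, regs_out, List.length_nil] at h₂
    have hc := runs_clear (Γ := RegAlphabet) (k := .inp) i
      (s := regs i (tape (f l)).reverse [] []) rfl
    rw [update_regs_inp] at hc
    refine (hi.seq (hc.seq runs_move_out_inp)).of_eq ?_ ?_ ?_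
    · exact (congrArg _ (List.map_id _)).trans (single_inp _)
    · rw [List.reverse_reverse, List.append_nil]
      exact (congrArg _ (List.map_id _)).trans (single_inp _)
    · simp only [Polynomial.eval_add, Polynomial.eval_mul, Polynomial.eval_ofNat,
        Polynomial.eval_X]
      omega

/-- A program for `doubleReplies`. -/
noncomputable def doubleReplies : PolyTimeProgram tape tape doubleReplies :=
  ofRegs _ (copyTwo.seq doubleStrings) (17 * Polynomial.X + 10) fun l => by
    refine ⟨[], ((runs_copyTwo l).seq (runs_doubleStrings (l.drop 2))).of_eq rfl ?_ ?_⟩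
    · simp [CVPV.doubleReplies, tape_append]
    · have := tape_drop_length_le l 2
      simp
      omega

/-- A program for `encodeView`. -/
noncomputable def encodeView : PolyTimeProgram tape tape encodeView :=
  -- The symbol pushed on `aux` raises the count from `i` to `i + 1`.
  ofRegs _ (copyTwo.seq (countString.seq ((push (Γ := RegAlphabet) .aux none).seq codePairs)))
    (9 * Polynomial.X + 15 + (Polynomial.X + 1) * (5 * Polynomial.X + 12)) fun l => by
    obtain ⟨l', h⟩ := runs_codePairs (o := (tape (l.take 2)).reverse ++ []) (b := [])
      (((l.drop 2).headD []).length + 1) (tape l).length (l.drop 3) (tape_drop_length_le l 3)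
    have hc := runs_countString (o := (tape (l.take 2)).reverse ++ []) (b := []) (l.drop 2)
    rw [List.drop_drop] at hc
    refine ⟨tape l', ((runs_copyTwo l).seq (hc.seq (runs_push_aux.seq h))).of_eq rfl ?_ ?_⟩
    · simp [CVPV.encodeView, tape_append]
    · have h₁ := tape_drop_length_le l 2
      have h₂ : ((l.drop 2).headD []).length ≤ (tape (l.drop 2)).length := by
        cases l.drop 2 with
        | nil => simp
        | cons y l => simp [tape_cons]
      have h₃ := Nat.mul_le_mul_right (5 * (tape l).length + 12)
        (Nat.add_le_add_right (h₂.trans h₁) 1)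
      simp only [Polynomial.eval_add, Polynomial.eval_mul, Polynomial.eval_ofNat,
        Polynomial.eval_X, Polynomial.eval_one]
      omega

end PolyTimeProgram

end CVPV

namespace CVPV

/-! ## Closure properties of polynomial time -/

theorem PolyTime.comp_program {f : List Str → Str} (hf : PolyTime f) {g : List Str → List Str}
    (P : PolyTimeProgram tape tape g) : PolyTime (f ∘ g) := by
  obtain ⟨Q⟩ := PolyTimeProgram.nonempty_of_tm2 hf.some
  exact (Q.comp P).tm2

theorem PolyTime.pairCode {f g : List Str → Str} (hf : PolyTime f) (hg : PolyTime g) :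
    PolyTime fun l => pairCode (f l) (g l) := by
  obtain ⟨P⟩ := PolyTimeProgram.nonempty_of_tm2 hf.some
  obtain ⟨Q⟩ := PolyTimeProgram.nonempty_of_tm2 hg.some
  exact (P.pair Q).tm2

theorem polyTime_const (b : Str) : PolyTime fun _ => b :=
  (PolyTimeProgram.const b).tm2

theorem polyTimeNat_const (b : ℕ) : PolyTimeNat fun _ => b :=
  (PolyTimeProgram.const b).tm2

/-! ## From position verification to proofs of quantumness -/

variable {p : ℝ}

/-- The interactive protocol in which one verifier plays the parts of both verifiers. -/
def PVProtocol.toInteractive (V : PVProtocol p) : InteractiveProtocol where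
  rounds := V.rounds
  msgLen := V.msgLen
  coins := V.coins
  next := (fun l => pairCode (V.send false l) (V.send true l)) ∘ doubleReplies
  next_poly := ((V.send_poly false).pairCode (V.send_poly true)).comp_program .doubleReplies
  accept := V.accept ∘ doubleReplies
  accept_poly := V.accept_poly.comp_program .doubleReplies

/-- On `1ⁿ, r, ys` the function `doubleReplies` unfolds to what the verifiers read from an honest
prover, so the two experiments agree by definition. -/
theorem PVProtocol.quantumProb_toInteractive (V : PVProtocol p) (Q : QuantumProver) (n : ℕ) :
    V.toInteractive.quantumProb Q n = V.honestProb Q n := rfl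

/-- The adversaries at the positions of the verifiers who simulate a classical prover. Each of them
answers the verifier at the same place. -/
def ClassicalProver.toAdversaries (P : ClassicalProver) (hp : p ∈ Set.Ioo (0 : ℝ) 1) :
    Adversaries p where
  num a _ := if a then 1 else 0
  den _ _ := 1
  num_poly _ := polyTimeNat_const _
  den_poly _ := polyTimeNat_const _
  left_mem _ := by simpa using hp.1
  right_mem _ := by simpa using hp.2
  coins := P.coins
  act a v := if a = v then P.reply ∘ encodeView else fun _ => []
  act_poly a v := by
    split_ifs
    · exact P.reply_poly.comp_program .encodeView
    · exact polyTime_const []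

theorem ClassicalProver.pos_toAdversaries (P : ClassicalProver) (hp : p ∈ Set.Ioo (0 : ℝ) 1)
    (n : ℕ) (a : Bool) : (P.toAdversaries hp).pos n a = loc a := by
  cases a <;> simp [Adversaries.pos, ClassicalProver.toAdversaries, loc]

/-- The messages of the next round pass `p` after the current reply and no later than the next one.
-/
theorem PVProtocol.replyTime_mono (V : PVProtocol p) (n : ℕ) {j i : ℕ} (hji : j ≤ i)
    (hi : i < V.rounds.eval n) : V.replyTime n j ≤ V.replyTime n i := by
  induction i, hji using Nat.le_induction with
  | base => exact le_rfl
  | succ i _ ih =>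
    have h₁ := V.reply_lt_send n false i hi
    have h₂ := V.send_le_reply n false (i + 1) hi
    linarith [ih (by omega)]

/-- The deadline leaves time for the way from `b` to `p` and on to `v`. The message reaches `v`
directly, and the detour through `p` is at least as long. -/
theorem ClassicalProver.knows_toAdversaries (P : ClassicalProver) (hp : p ∈ Set.Ioo (0 : ℝ) 1)
    (V : PVProtocol p) (n : ℕ) (v b : Bool) {i j : ℕ} (hji : j ≤ i) (hi : i < V.rounds.eval n) :
    (P.toAdversaries hp).Knows V n v v i b j := by
  have h₁ := V.send_le_reply n b j (by omega)
  have h₂ := V.replyTime_mono n hji hi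
  have h₃ := V.reply_le_deadline n v i hi
  -- `Knows` asks for a strict inequality between sending time and deadline; it holds because `p` is
  -- at neither end.
  have hpos : 0 < |p - loc b| := by
    rw [abs_pos, sub_ne_zero]
    cases b
    · simpa [loc] using hp.1.ne'
    · simpa [loc] using hp.2.ne
  -- The relay is the adversary at the place of `b`, who observes the broadcast without delay.
  refine ⟨by linarith [abs_nonneg (p - loc v)], b, ?_⟩
  simp only [pos_toAdversaries, sub_self, abs_zero, add_zero]
  have := abs_sub_le (loc b) p (loc v)
  rw [abs_sub_comm (loc b) p] at this
  linarith

theorem pairTails_flatMap (w : Bool → ℕ → Str) (k : ℕ) (l : List ℕ) :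
    pairTails k (l.flatMap fun j => [w false j, w true j]) =
      (l.take k).map fun j => pairCode (w false j).tail (w true j).tail := by
  induction l generalizing k with
  | nil => cases k <;> rfl
  | cons j l ih =>
    cases k with
    | zero => rfl
    | succ k => simpa [pairTails] using ih k

theorem pairTails_rows (w : Bool → ℕ → Str) (k n : ℕ) :
    pairTails k (rows w n) =
      (List.range (min k n)).map fun j => pairCode (w false j).tail (w true j).tail := by
  rw [← List.take_range]
  exact pairTails_flatMap w k (List.range n)

/-- All messages up to round `i` are known in time, and `encodeView` cuts off whatever is known of
later rounds. So `P` is run on exactly the history it would have in the interactive protocol. -/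
theorem ClassicalProver.sent_toAdversaries (P : ClassicalProver) (hp : p ∈ Set.Ioo (0 : ℝ) 1)
    (V : PVProtocol p) (n : ℕ) (ρ : Str) (v : Bool) {i : ℕ} (hi : i < V.rounds.eval n)
    (m : Bool → ℕ → Str) :
    (P.toAdversaries hp).sent V n ρ v v i m = P.reply (unary n :: ρ ::
      (List.range (i + 1)).map fun j => pairCode (m false j) (m true j)) := by
  classical
  have hact : (P.toAdversaries hp).act v v = P.reply ∘ encodeView := if_pos rfl
  rw [Adversaries.sent, hact, Function.comp_apply]
  have henc : ∀ w : List Str, encodeView (unary n :: ρ :: unary i :: w) =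
      unary n :: ρ :: pairTails (i + 1) w := by
    intro w
    simp [encodeView, unary]
  rw [henc, Adversaries.view, pairTails_rows, min_eq_left hi]
  congr 3
  refine List.map_congr_left fun j hj => ?_
  have hj : j ≤ i := by simpa [Nat.lt_succ_iff] using hj
  -- A known message carries the marker `true`, which `tail` removes.
  simp [P.knows_toAdversaries hp V n v _ hj hi]

theorem ClassicalProver.sent_toAdversaries_of_ne (P : ClassicalProver)
    (hp : p ∈ Set.Ioo (0 : ℝ) 1) (V : PVProtocol p) (n : ℕ) (ρ : Str) {a v : Bool} (h : a ≠ v)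
    (i : ℕ) (m : Bool → ℕ → Str) : (P.toAdversaries hp).sent V n ρ a v i m = [] := by
  have hact : (P.toAdversaries hp).act a v = fun _ => [] := if_neg h
  rw [Adversaries.sent, hact]

/-- The reply number `i` of a classical prover. -/
def ClassicalProver.replyAt (P : ClassicalProver) (n L : ℕ) (ρ : Str) (env : List Str → Str)
    (i : ℕ) : Str :=
  (P.reply (unary n :: ρ :: (P.transcript n L ρ env (i + 1)).1)).take L

/-- `IsRun` treats messages as functions of the round number; this puts the recursive transcript
into that form. -/
theorem ClassicalProver.transcript_eq (P : ClassicalProver) (n L : ℕ) (ρ : Str)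
    (env : List Str → Str) (k : ℕ) :
    P.transcript n L ρ env k =
      ((List.range k).map fun j => env ((List.range j).map (P.replyAt n L ρ env)),
        (List.range k).map (P.replyAt n L ρ env)) := by
  induction k with
  | zero => rfl
  | succ k ih =>
    refine Prod.ext ?_ ?_
    · rw [transcript, List.range_succ, List.map_append, ih]
      rfl
    · have : (P.transcript n L ρ env (k + 1)).2 =
          (P.transcript n L ρ env k).2 ++ [P.replyAt n L ρ env k] := rfl
      rw [this, ih]
      simp [List.range_succ]

theorem rows_const (y : ℕ → Str) (i : ℕ) :
    rows (fun _ => y) i = heardByBoth ((List.range i).map y) := by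
  simp [rows, heardByBoth, List.flatMap_map]

/-- Both adversaries compute the same reply from the same tape and messages. So the two verifiers
read equal replies, as if one prover had broadcast them, and their next messages are those of the
single verifier. -/
theorem ClassicalProver.exists_isRun (P : ClassicalProver) (hp : p ∈ Set.Ioo (0 : ℝ) 1)
    (V : PVProtocol p) (n : ℕ) (r ρ : Str) :
    ∃ m c, (P.toAdversaries hp).IsRun V n r ρ m c ∧
      rows c (V.rounds.eval n) = heardByBoth (P.transcript n (V.msgLen.eval n) ρ
        (fun ys => V.toInteractive.next (unary n :: r :: ys)) (V.rounds.eval n)).2 := by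
  set env : List Str → Str := fun ys => V.toInteractive.next (unary n :: r :: ys) with henv
  set y := P.replyAt n (V.msgLen.eval n) ρ env with hy
  refine ⟨fun v i => V.send v (unary n :: r :: rows (fun _ => y) i), fun _ => y,
    fun i hi v => ⟨rfl, ?_⟩, ?_⟩
  · have hx : ((List.range (i + 1)).map fun j =>
        pairCode (V.send false (unary n :: r :: rows (fun _ => y) j))
          (V.send true (unary n :: r :: rows (fun _ => y) j))) =
        (P.transcript n (V.msgLen.eval n) ρ env (i + 1)).1 := by
      rw [transcript_eq]
      refine List.map_congr_left fun j _ => ?_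
      rw [rows_const]
      rfl
    rw [P.sent_toAdversaries hp V n ρ v hi,
      P.sent_toAdversaries_of_ne hp V n ρ (by cases v <;> simp), hx]
    -- If `P` answers with the empty string, the other adversary is heard instead, who is also
    -- silent towards this verifier.
    split_ifs with h
    · change (P.reply (unary n :: ρ :: _)).take _ = _
      rw [h]
    · rfl
  · rw [rows_const, transcript_eq]

theorem coinAvg_mono (k : ℕ) {f g : Str → ℝ} (h : ∀ r, f r ≤ g r) : coinAvg k f ≤ coinAvg k g :=
  div_le_div_of_nonneg_right (Finset.sum_le_sum fun _ _ => h _) (by positivity)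

/-- The comparison is made for each pair of tapes: an accepting transcript provides an accepting
run. -/
theorem PVProtocol.classicalProb_le_advProb (V : PVProtocol p) (hp : p ∈ Set.Ioo (0 : ℝ) 1)
    (P : ClassicalProver) (n : ℕ) :
    V.toInteractive.classicalProb P n ≤ V.advProb (P.toAdversaries hp) n := by
  refine coinAvg_mono _ fun r => coinAvg_mono _ fun ρ => ?_
  split_ifs with h₁ h₂ h₂
  · exact le_rfl
  · obtain ⟨m, c, hrun, hc⟩ := P.exists_isRun hp V n r ρ
    refine absurd ⟨m, c, hrun, ?_⟩ h₂
    rw [hc]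
    exact h₁
  · exact zero_le_one
  · exact le_rfl

end CVPV

theorem mainTheorem9 (p : ℝ) (hp : p ∈ Set.Ioo (0 : ℝ) 1) (c s : ℕ+ → ℝ)
    (hPV : ∃ V : CVPV.PVProtocol p, V.Complete c ∧ V.Sound s) :
    ∃ V : CVPV.InteractiveProtocol, V.IsProofOfQuantumness c s := by
  obtain ⟨V, ⟨Q, hQ⟩, hV⟩ := hPV
  refine ⟨V.toInteractive, ⟨Q, fun n => ?_⟩, fun P => ?_⟩
  · rw [V.quantumProb_toInteractive]
    exact hQ n
  · obtain ⟨ν, hν, h⟩ := hV (P.toAdversaries hp)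
    exact ⟨ν, hν, fun n => (V.classicalProb_le_advProb hp P n).trans (h n)⟩
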